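/- **Theorem.** Let graphs be simple graphs on the vertex set $\{0,\dots,n-1\}$, given by adjacency lists in arbitrary order, and write $\bar d_G=\frac1n\sum_v \deg(v)$. Algorithms are randomized real-RAM programs (unit-cost operations $+,-,\times,/,\lfloor\cdot\rfloor,\exp,\log$, comparisons, memory accesses with indirect addressing, bounded loops, access to a string of independent uniform samples from $[0,1]$) that receive $n,\varepsilon,\rho$ as input and access the graph $G$ only through degree queries ($v\mapsto\deg(v)$) and neighbor queries ($(v,i)\mapsto$ the $i$-th neighbor of $v$, or $\perp$ if there is none), each at unit cost. Two graphs on the same vertex set are edge-neighboring if there is an $e$ with $E_1\setminus\{e\}=E_2\setminus\{e\}$. There are a single such algorithm $\mathcal A$, a constant $C$ and exponents $a,b\in\mathbb N$ such that the following hold. 1. (Privacy) For all $n$, $\varepsilon>0$ and $\rho>0$, $\mathcal A$ is $\varepsilon$-edge-differentially private: for all edge-neighboring $n$-vertex graphs $G_1,G_2$, with any adjacency lists, and every measurable set $S\subseteq\mathbb R$, $$\Pr[\mathcal A(G_1)\in S]\le e^{\varepsilon}\,\Pr[\mathcal A(G_2)\in S].$$ 2. (Running time) For all $n\ge1$, $\varepsilon>0$,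 $\rho>0$, on every $n$-vertex graph and for every outcome of the random string, $\mathcal A$ performs at most $$C\,\sqrt n\,\Bigl(1+\frac{\log n}{\rho}\Bigr)^{a}\Bigl(1+\frac1\varepsilon\Bigr)^{b}$$ elementary steps, queries included. 3. (Accuracy) For every constant $\rho>0$ and every sequence $\varepsilon=\varepsilon(n)>0$ with $\varepsilon(n)^{-1}=o(\log^{1/4}n)$ there is a sequence $\delta(n)\to0$ such that, for every $n$ and every $n$-vertex graph $G$ with $\bar d_G\ge1$, the output $\tilde d$ of $\mathcal A$ run with parameters $\varepsilon(n)$ and $\rho$ satisfies $$(1-\rho)\,\bar d_G\le\tilde d\le(1+\rho)\,\bar d_G\qquad\text{with probability at least }1-\delta(n).$$ -/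

import Mathlib

open MeasureTheory Filter Topology Asymptotics
open scoped ENNReal

namespace SublinearDP

/-! ### Graphs and query access -/

/-- The average degree of a graph on the vertex set `{0, …, n - 1}`. -/
noncomputable def avgDegree {n : ℕ} (G : SimpleGraph (Fin n)) : ℝ :=
  open Classical in (∑ v, (G.degree v : ℝ)) / n

/-- Two graphs on the same vertex set are edge-neighboring if there is an edge `e` such that they
agree outside `e`. -/
def EdgeNeighboring {n : ℕ} (G₁ G₂ : SimpleGraph (Fin n)) : Prop :=
  ∃ e : Sym2 (Fin n), G₁.edgeSet \ {e} = G₂.edgeSet \ {e}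

/-- A presentation of `G` by adjacency lists: for every vertex an enumeration, in an arbitrary
order, of its neighbors. This is what the neighbor queries refer to. -/
structure AdjLists {n : ℕ} (G : SimpleGraph (Fin n)) where
  nbrs : Fin n → List (Fin n)
  nodup : ∀ v, (nbrs v).Nodup
  mem_nbrs : ∀ v w, w ∈ nbrs v ↔ G.Adj v w

/-- Degree query: the degree of vertex `v` (and `0` if `v` is not a vertex). -/
noncomputable def AdjLists.degQuery {n : ℕ} {G : SimpleGraph (Fin n)} (_ : AdjLists G)
    (v : ℕ) : ℝ :=
  open Classical in if h : v < n then (G.degree ⟨v, h⟩ : ℝ) else 0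

/-- Neighbor query: the `i`-th neighbor of vertex `v`, where the neighbors of `v` are numbered
`0, …, deg v - 1`. The answer `-1` stands for `⊥`, and is returned if there is no such neighbor. -/
def AdjLists.nbrQuery {n : ℕ} {G : SimpleGraph (Fin n)} (L : AdjLists G) (v i : ℕ) : ℝ :=
  if h : v < n then
    match (L.nbrs ⟨v, h⟩)[i]? with
    | some w => (w : ℕ)
    | none => -1
  else -1

/-! ### Randomized real-RAM programs with query access to a graph

A memory cell holds a real number. Cells are addressed by natural numbers; wherever a natural
number is expected (an address, a vertex, an index, a number of iterations), the real number at
hand is rounded down, and replaced by `0` if it is negative. -/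

/-- Contents of the memory. -/
abbrev Mem := ℕ → ℝ

/-- The random string: independent uniform samples from `[0, 1]`. -/
abbrev Coins := ℕ → unitInterval

/-- The law of the random string. -/
noncomputable def coinLaw : Measure Coins :=
  Measure.infinitePi fun _ : ℕ => (volume : Measure unitInterval)

/-- Expressions. Each node is one elementary operation. -/
inductive Expr : Type
  /-- a rational constant -/
  | const (q : ℚ)
  /-- the contents of the cell with address `a` -/
  | get (a : Expr)
  | add (a b : Expr)
  | sub (a b : Expr)
  | mul (a b : Expr)
  | div (a b : Expr)
  | floor (a : Expr)
  | exp (a : Expr)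
  | log (a : Expr)
  /-- the entry with index `i` of the random string -/
  | coin (i : Expr)
  /-- a degree query -/
  | deg (v : Expr)
  /-- a neighbor query -/
  | nbr (v i : Expr)

/-- The number of elementary operations (queries included) in the evaluation of an expression. -/
def Expr.cost : Expr → ℕ
  | const _ => 1
  | get a => a.cost + 1
  | add a b => a.cost + b.cost + 1
  | sub a b => a.cost + b.cost + 1
  | mul a b => a.cost + b.cost + 1
  | div a b => a.cost + b.cost + 1
  | floor a => a.cost + 1
  | exp a => a.cost + 1
  | log a => a.cost + 1
  | coin i => i.cost + 1
  | deg v => v.cost + 1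
  | nbr v i => v.cost + i.cost + 1

/-- The value of an expression. -/
noncomputable def Expr.val {n : ℕ} {G : SimpleGraph (Fin n)} (L : AdjLists G) (ω : Coins)
    (m : Mem) : Expr → ℝ
  | const q => q
  | get a => m ⌊a.val L ω m⌋₊
  | add a b => a.val L ω m + b.val L ω m
  | sub a b => a.val L ω m - b.val L ω m
  | mul a b => a.val L ω m * b.val L ω m
  | div a b => a.val L ω m / b.val L ω m
  | floor a => (⌊a.val L ω m⌋ : ℤ)
  | exp a => Real.exp (a.val L ω m)
  | log a => Real.log (a.val L ω m)
  | coin i => (ω ⌊i.val L ω m⌋₊ : ℝ)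
  | deg v => L.degQuery ⌊v.val L ω m⌋₊
  | nbr v i => L.nbrQuery ⌊v.val L ω m⌋₊ ⌊i.val L ω m⌋₊

/-- Programs. All loops have a number of iterations that is fixed on entry, so that every program
halts. -/
inductive Prog : Type
  /-- write the value of `e` into the cell with address `a` -/
  | assign (a e : Expr)
  /-- run `p`, then `q` -/
  | seq (p q : Prog)
  /-- run `p` if `a ≤ b`, and `q` otherwise -/
  | cond (a b : Expr) (p q : Prog)
  /-- run `p` repeatedly; the number of iterations is the value of `k` on entry -/
  | loop (k : Expr) (p : Prog)

/-- The effect of a program on a pair consisting of the memory and the number of elementary steps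
executed so far. -/
noncomputable def Prog.run {n : ℕ} {G : SimpleGraph (Fin n)} (L : AdjLists G) (ω : Coins) :
    Prog → Mem × ℕ → Mem × ℕ
  | assign a e => fun s =>
      (Function.update s.1 ⌊a.val L ω s.1⌋₊ (e.val L ω s.1), s.2 + (a.cost + e.cost + 1))
  | seq p q => fun s => q.run L ω (p.run L ω s)
  | cond a b p q => fun s =>
      open Classical in
      if a.val L ω s.1 ≤ b.val L ω s.1 then p.run L ω (s.1, s.2 + (a.cost + b.cost + 1))
      else q.run L ω (s.1, s.2 + (a.cost + b.cost + 1))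
  | loop k p => fun s =>
      (fun s' : Mem × ℕ => p.run L ω (s'.1, s'.2 + 1))^[⌊k.val L ω s.1⌋₊]
        (s.1, s.2 + (k.cost + 1))

/-- The initial memory: cells `0`, `1`, `2` hold the number of vertices `n`, the privacy parameter
`ε` and the accuracy parameter `ρ`; all other cells hold `0`. -/
def initMem (n : ℕ) (ε ρ : ℝ) : Mem
  | 0 => n
  | 1 => ε
  | 2 => ρ
  | _ => 0

/-- The output: the final contents of cell `0`. -/
noncomputable def Prog.output (P : Prog) {n : ℕ} {G : SimpleGraph (Fin n)} (L : AdjLists G)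
    (ε ρ : ℝ) (ω : Coins) : ℝ :=
  (P.run L ω (initMem n ε ρ, 0)).1 0

/-- The running time: the number of elementary steps, each query being one of them. -/
noncomputable def Prog.time (P : Prog) {n : ℕ} {G : SimpleGraph (Fin n)} (L : AdjLists G)
    (ε ρ : ℝ) (ω : Coins) : ℕ :=
  (P.run L ω (initMem n ε ρ, 0)).2

/-- The probability that the output lies in `S`. -/
noncomputable def Prog.prob (P : Prog) {n : ℕ} {G : SimpleGraph (Fin n)} (L : AdjLists G)
    (ε ρ : ℝ) (S : Set ℝ) : ℝ≥0∞ :=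
  coinLaw {ω | P.output L ε ρ ω ∈ S}

/-- `P`, run with parameters `ε` and `ρ` on graphs with `n` vertices, is `ε`-edge-differentially
private, whatever the order of the adjacency lists. -/
def Prog.IsEdgeDP (P : Prog) (n : ℕ) (ε ρ : ℝ) : Prop :=
  ∀ (G₁ G₂ : SimpleGraph (Fin n)), EdgeNeighboring G₁ G₂ →
    ∀ (L₁ : AdjLists G₁) (L₂ : AdjLists G₂) (S : Set ℝ), MeasurableSet S →
      P.prob L₁ ε ρ S ≤ ENNReal.ofReal (Real.exp ε) * P.prob L₂ ε ρ S

end SublinearDP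

/-! About √n samples miss the few vertices of very high degree, so the edges at those vertices are
counted from their other endpoint. Every vertex gets a noisy degree, and is heavy if this exceeds a
threshold `T`. A sampled light vertex contributes its degree, doubled if a random neighbor is heavy;
a heavy one contributes nothing. With `H` the indicator of heaviness and the cap inactive, the
contributions sum on average to (1 - H v)(1 + H w) over ordered adjacent pairs. The linear terms
cancel by symmetry, so only pairs of heavy vertices are lost, at most the square of the number of
heavy vertices (`sum_meanContrib`).

Put l = `logFactor n ρ`. The threshold is the largest noisy degree among about √n l² random
vertices. Hence fewer than √n / l vertices are heavy with high probability
(`coinLaw_heavyCount_le`), and the bias is at most a fraction 1 / l² of n. Markov's inequality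
bounds the sampled degrees, hence `T`, so contributions are small enough for Chebyshev's inequality
with about √n l⁶ samples (`coinLaw_deviation_le`), and for the final noise to be negligible.

For privacy, `estimateOf` separates the noisy degrees from the true degrees and neighbors. An edge
changes at most two degrees, each by at most one, and passing to the other graph's noisy degrees
costs ε/4 per endpoint (`coinLaw_estimateOf_le_of_noisyDeg`). With the noisy degrees fixed, the
graph matters only in samples that hit an endpoint; stratification bounds their number for every
outcome of the coins (`card_sampleVertex_eq_le`), so the noise added to the sum costs the remaining
ε/2 (`coinLaw_estimateOf_le_of_degrees`). Adjacency orders away from the endpoints are matched at no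
cost (`coinLaw_estimateOf_eq`). Logistic noise serves throughout: it is one logarithm of a uniform
sample, and shifts of it are Lipschitz maps of the unit interval (`volume_logit_le`). -/

namespace SublinearDP

/-! ### The estimator as a function of the random string -/

/-- The quantile function of the logistic distribution. -/
noncomputable def logit (x : ℝ) : ℝ := Real.log (x / (1 - x))

noncomputable def logFactor (n : ℕ) (ρ : ℝ) : ℝ := 1 + Real.log n / ρ

/-- `√n`, computed with the operations of the machine. -/
noncomputable def rootSize (n : ℕ) : ℝ := Real.exp (Real.log n / 2)

/-- The number of samples that determine the degree threshold. -/
noncomputable def preSize (n : ℕ) (ρ : ℝ) : ℕ := ⌊rootSize n * logFactor n ρ ^ 2⌋₊ + 1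

/-- The number of samples that enter the estimate. -/
noncomputable def sampleSize (n : ℕ) (ρ : ℝ) : ℕ := ⌊rootSize n * logFactor n ρ ^ 6⌋₊ + 1

/-- Degrees perturbed by logistic noise; the noise of vertex `v` is read off coin `4 v + 4`. -/
noncomputable def noisyDeg (ε : ℝ) (dg : ℕ → ℝ) (ω : Coins) (v : ℕ) : ℝ :=
  dg v + 4 / ε * logit (ω (4 * v + 4))

/-- The value is `n`, not a vertex, when the coin equals 1; the degree query then answers 0. -/
noncomputable def preVertex (n : ℕ) (ω : Coins) (j : ℕ) : ℕ := ⌊(n : ℝ) * ω (4 * j + 1)⌋₊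

/-- The maximum of `0` and the first `k` terms of a sequence. -/
noncomputable def runMax (f : ℕ → ℝ) : ℕ → ℝ
  | 0 => 0
  | k + 1 => max (runMax f k) (f k)

noncomputable def threshold (n : ℕ) (ρ : ℝ) (D : ℕ → ℝ) (ω : Coins) : ℝ :=
  runMax (fun j => D (preVertex n ω j)) (preSize n ρ)

/-- An upper bound, valid with high probability, for the degrees of the vertices whose noisy degree
is at most `T`. -/
noncomputable def degCap (n : ℕ) (ε T : ℝ) : ℝ := T + 8 * Real.log n / ε + 1

/-- The contribution of a sampled vertex of degree `d` and noisy degree `Dv`, a random neighbor of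
which has noisy degree `Du`. -/
noncomputable def contrib (T cap d Dv Du : ℝ) : ℝ :=
  if Dv ≤ T then (if Du ≤ T then min d cap else 2 * min d cap) else 0

/-- One point is drawn in each of `k` equal strata of the interval from 0 to `n`. This keeps the
samples uniform on average but limits how often a single vertex can occur. -/
noncomputable def sampleVertex (n k : ℕ) (ω : Coins) (j : ℕ) : ℕ :=
  ⌊((j : ℝ) + ω (4 * j + 2)) * ((n : ℝ) / k)⌋₊

/-- The oracle may depend on the sample index `j`, so that a hybrid argument can change it for one
sample at a time. -/
noncomputable def sampleNbr (d : ℕ → ℝ) (nb : ℕ → ℕ → ℕ → ℕ) (n k : ℕ) (ω : Coins) (j : ℕ) : ℕ :=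
  nb j (sampleVertex n k ω j) ⌊(ω (4 * j + 3) : ℝ) * d (sampleVertex n k ω j)⌋₊

noncomputable def sampleTerm (n k : ℕ) (d : ℕ → ℝ) (nb : ℕ → ℕ → ℕ → ℕ) (T cap : ℝ)
    (D : ℕ → ℝ) (ω : Coins) (j : ℕ) : ℝ :=
  contrib T cap (d (sampleVertex n k ω j)) (D (sampleVertex n k ω j))
    (D (sampleNbr d nb n k ω j))

noncomputable def sampleSum (n k : ℕ) (d : ℕ → ℝ) (nb : ℕ → ℕ → ℕ → ℕ) (T cap : ℝ)
    (D : ℕ → ℝ) (ω : Coins) : ℝ :=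
  ∑ j ∈ Finset.range k, sampleTerm n k d nb T cap D ω j

/-- This is 2 / ε times the sensitivity bound 4 · cap · (k / n + 2) of `abs_sampleSum_sub_le`. -/
noncomputable def noiseScale (n k : ℕ) (ε cap : ℝ) : ℝ := 8 * cap * ((k : ℝ) / n + 2) / ε

/-- The estimate computed from the noisy degrees `D`, the degrees `d` and neighbor oracles `nb`. -/
noncomputable def estimateOf (n : ℕ) (ε ρ : ℝ) (d : ℕ → ℝ) (nb : ℕ → ℕ → ℕ → ℕ) (D : ℕ → ℝ)
    (ω : Coins) : ℝ :=
  (sampleSum n (sampleSize n ρ) d nb (threshold n ρ D ω) (degCap n ε (threshold n ρ D ω)) D ω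
    + noiseScale n (sampleSize n ρ) ε (degCap n ε (threshold n ρ D ω)) * logit (ω 0))
    / sampleSize n ρ

/-- The neighbor oracle of a family of adjacency lists; `⊥` is replaced by vertex `0`. -/
def AdjLists.nbrNat {n : ℕ} {G : SimpleGraph (Fin n)} (L : AdjLists G) (v i : ℕ) : ℕ :=
  if h : v < n then
    match (L.nbrs ⟨v, h⟩)[i]? with
    | some w => w
    | none => 0
  else 0

/-! ### The program -/

namespace Estimator
open SublinearDP.Expr SublinearDP.Prog

abbrev cell (q : ℚ) : Expr := get (const q)

abbrev set (q : ℚ) (e : Expr) : Prog := assign (const q) e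

abbrev logitE (x : Expr) : Expr := log (div x (sub (const 1) x))

/-- The noise of a vertex is always read from the same coin, so repeated evaluations agree without a
table of length `n`. -/
abbrev noisyDegE (v : Expr) : Expr :=
  add (deg v) (mul (div (const 4) (cell 1)) (logitE (coin (add (mul (const 4) v) (const 4)))))

/-- Memory layout: 3 and 4 hold the logarithmic factor and √n, 5 and 6 the two sample sizes, 7 the
threshold, 8 the loop counter, 10 the cap, 11 to 13 the current vertex, its degree and its neighbor,
14 the running sum. Cell 9 is scratch; writing 0 to it serves as an empty branch. -/
def setup : Prog :=
  seq (set 3 (add (const 1) (div (log (cell 0)) (cell 2))))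
  (seq (set 4 (exp (div (log (cell 0)) (const 2))))
  (seq (set 5 (add (floor (mul (cell 4) (mul (cell 3) (cell 3)))) (const 1)))
    (set 6 (add (floor (mul (cell 4) (mul (mul (mul (cell 3) (cell 3)) (mul (cell 3) (cell 3)))
      (mul (cell 3) (cell 3))))) (const 1)))))

def thresholdStep : Prog :=
  seq (set 9 (noisyDegE (floor (mul (cell 0) (coin (add (mul (const 4) (cell 8)) (const 1)))))))
  (seq (cond (cell 9) (cell 7) (set 9 (const 0)) (set 7 (cell 9)))
    (set 8 (add (cell 8) (const 1))))

def reset : Prog :=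
  seq (set 8 (const 0))
    (set 10 (add (add (cell 7) (div (mul (const 8) (log (cell 0))) (cell 1))) (const 1)))

def pickStep : Prog :=
  seq (set 11 (floor (mul (add (cell 8) (coin (add (mul (const 4) (cell 8)) (const 2))))
    (div (cell 0) (cell 6)))))
  (seq (set 12 (deg (cell 11)))
  (seq (set 13 (nbr (cell 11) (mul (coin (add (mul (const 4) (cell 8)) (const 3))) (cell 12))))
    (cond (cell 13) (const 0) (set 13 (const 0)) (set 9 (const 0)))))

def addStep : Prog :=
  seq (cond (noisyDegE (cell 11)) (cell 7)
    (seq (cond (cell 12) (cell 10) (set 9 (const 0)) (set 12 (cell 10)))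
      (cond (noisyDegE (cell 13)) (cell 7) (set 14 (add (cell 14) (cell 12)))
        (set 14 (add (cell 14) (mul (const 2) (cell 12))))))
    (set 9 (const 0)))
    (set 8 (add (cell 8) (const 1)))

def finish : Prog :=
  set 0 (div (add (cell 14) (mul (div (mul (mul (const 8) (cell 10))
    (add (div (cell 6) (cell 0)) (const 2))) (cell 1)) (logitE (coin (const 0))))) (cell 6))

def program : Prog :=
  seq setup (seq (loop (cell 5) thresholdStep) (seq reset
    (seq (loop (cell 6) (seq pickStep addStep)) finish)))

/-! ### Semantics of the program -/

variable {n : ℕ} {G : SimpleGraph (Fin n)} (L : AdjLists G) (ω : Coins)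

theorem run_seq (p q : Prog) (s : Mem × ℕ) : (p.seq q).run L ω s = q.run L ω (p.run L ω s) := rfl

theorem run_loop (k : Expr) (p : Prog) (s : Mem × ℕ) : (Prog.loop k p).run L ω s =
    (fun s' : Mem × ℕ => p.run L ω (s'.1, s'.2 + 1))^[⌊k.val L ω s.1⌋₊]
        (s.1, s.2 + (k.cost + 1)) := rfl

theorem natFloor_mul_add (a b : ℕ) (v : ℕ) : ⌊(a : ℝ) * (v : ℝ) + b⌋₊ = a * v + b := by
  exact_mod_cast Nat.floor_natCast (R := ℝ) (a * v + b)

theorem one_le_logFactor (n : ℕ) {ρ : ℝ} (hρ : 0 < ρ) : 1 ≤ logFactor n ρ := by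
  have : 0 ≤ Real.log n / ρ := div_nonneg (Real.log_natCast_nonneg n) hρ.le
  unfold logFactor; linarith

theorem noisyDegE_val (m : Mem) (v : Expr) {w : ℕ} (hv : v.val L ω m = w) :
    (noisyDegE v).val L ω m = noisyDeg (m 1) L.degQuery ω w := by
  have := natFloor_mul_add 4 4 w
  push_cast at this
  simp [Expr.val, noisyDeg, logit, hv, this]

theorem setup_run (n : ℕ) {G : SimpleGraph (Fin n)} (L : AdjLists G) {ε ρ : ℝ} (hρ : 0 < ρ) :
    let m := (setup.run L ω (initMem n ε ρ, 0)).1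
    m 0 = n ∧ m 1 = ε ∧ m 5 = preSize n ρ ∧ m 6 = sampleSize n ρ ∧ m 7 = 0 ∧ m 8 = 0 ∧
      m 14 = 0 := by
  have hl := one_le_logFactor n hρ
  have h0 : 0 ≤ rootSize n * logFactor n ρ ^ 2 := by unfold rootSize; positivity
  have h1 : 0 ≤ rootSize n * logFactor n ρ ^ 6 := by unfold rootSize; positivity
  have e0 : Real.exp (Real.log n / 2) * ((1 + Real.log n / ρ) * (1 + Real.log n / ρ)) =
    rootSize n * logFactor n ρ ^ 2 := by rw [rootSize, logFactor]; ring
  have e1 : Real.exp (Real.log n / 2) * ((1 + Real.log n / ρ) * (1 + Real.log n / ρ) *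
      ((1 + Real.log n / ρ) * (1 + Real.log n / ρ)) * ((1 + Real.log n / ρ) *
      (1 + Real.log n / ρ))) =
    rootSize n * logFactor n ρ ^ 6 := by rw [rootSize, logFactor]; ring
  simp [Prog.run, Expr.val, initMem, e0, e1, preSize, sampleSize,
    setup, ← natCast_floor_eq_intCast_floor h0, ← natCast_floor_eq_intCast_floor h1]

theorem thresholdStep_run (s : Mem × ℕ) {j : ℕ} (h0 : s.1 0 = n) (h8 : s.1 8 = j) :
    let m := (thresholdStep.run L ω s).1
    (∀ a, a ≠ 7 → a ≠ 8 → a ≠ 9 → m a = s.1 a) ∧ m 8 = (j + 1 : ℕ) ∧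
      m 7 = max (s.1 7) (noisyDeg (s.1 1) L.degQuery ω (preVertex n ω j)) := by
  have hc := natFloor_mul_add 4 1 j
  push_cast at hc
  have hv : (floor (mul (cell 0) (coin (add (mul (const 4) (cell 8)) (const 1))))).val L ω s.1 =
      preVertex n ω j := by
    have : (0 : ℝ) ≤ n * ω (4 * j + 1) := mul_nonneg (by positivity) (ω _).2.1
    simp [Expr.val, h0, h8, hc, preVertex, natCast_floor_eq_intCast_floor this]
  have hD := noisyDegE_val L ω s.1 _ hv
  simp only [thresholdStep, Prog.run, hD]
  by_cases h : noisyDeg (s.1 1) L.degQuery ω (preVertex n ω j) ≤ s.1 7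
  · rw [max_eq_left h]
    simp +contextual [Expr.val, Function.update_apply, h, h8]
  · rw [max_eq_right (not_le.1 h).le]
    simp +contextual [Expr.val, Function.update_apply, h, h8]

theorem reset_run (s : Mem × ℕ) (h0 : s.1 0 = n) :
    let m := (reset.run L ω s).1
    (∀ a, a ≠ 8 → a ≠ 10 → m a = s.1 a) ∧ m 8 = 0 ∧ m 10 = degCap n (s.1 1) (s.1 7) := by
  simp +contextual [reset, Prog.run, Expr.val, h0, degCap]

/-- The machine answers -1 for a missing neighbor while the estimator uses vertex 0; the conditional
in `pickStep` reconciles the two. -/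
theorem nbrQuery_eq (v i : ℕ) : L.nbrQuery v i = L.nbrNat v i ∨
    (L.nbrQuery v i = -1 ∧ L.nbrNat v i = 0) := by
  unfold AdjLists.nbrQuery AdjLists.nbrNat
  split_ifs with h
  · cases (L.nbrs ⟨v, h⟩)[i]? <;> simp
  · simp

theorem pickStep_run (s : Mem × ℕ) {j k : ℕ} (h0 : s.1 0 = n) (h6 : s.1 6 = k) (h8 : s.1 8 = j) :
    let m := (pickStep.run L ω s).1
    (∀ a, a ≠ 9 → a ≠ 11 → a ≠ 12 → a ≠ 13 → m a = s.1 a) ∧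
      m 11 = sampleVertex n k ω j ∧ m 12 = L.degQuery (sampleVertex n k ω j) ∧
      m 13 = sampleNbr L.degQuery (fun _ => L.nbrNat) n k ω j := by
  have hc := natFloor_mul_add 4 2 j
  have hc' := natFloor_mul_add 4 3 j
  push_cast at hc hc'
  have hv : ((⌊((j : ℝ) + ω (4 * j + 2)) * ((n : ℝ) / k)⌋ : ℤ) : ℝ) = sampleVertex n k ω j := by
    have : (0 : ℝ) ≤ ((j : ℝ) + ω (4 * j + 2)) * ((n : ℝ) / k) :=
      mul_nonneg (add_nonneg (by positivity) (ω _).2.1) (by positivity)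
    rw [sampleVertex, natCast_floor_eq_intCast_floor this]
  have hq := nbrQuery_eq L (sampleVertex n k ω j)
    ⌊(ω (4 * j + 3) : ℝ) * L.degQuery (sampleVertex n k ω j)⌋₊
  rcases hq with hq | ⟨hq, hq'⟩
  · by_cases h : L.nbrNat (sampleVertex n k ω j)
      ⌊(ω (4 * j + 3) : ℝ) * L.degQuery (sampleVertex n k ω j)⌋₊ = 0
    · simp +contextual [pickStep, Prog.run, Expr.val, h0, h6, h8, hc, hc', hv, hq, h,
        sampleNbr]
    · simp +contextual [pickStep, Prog.run, Expr.val, h0, h6, h8, hc, hc', hv, hq, h,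
        sampleNbr]
  · simp +contextual [pickStep, Prog.run, Expr.val, h0, h6, h8, hc, hc', hv, hq, hq',
        sampleNbr]

theorem addStep_run (s : Mem × ℕ) {j v u : ℕ} (h8 : s.1 8 = j) (h11 : s.1 11 = v)
    (h13 : s.1 13 = u) :
    let m := (addStep.run L ω s).1
    (∀ a, a ≠ 8 → a ≠ 9 → a ≠ 12 → a ≠ 14 → m a = s.1 a) ∧ m 8 = (j + 1 : ℕ) ∧
      m 14 = s.1 14 + contrib (s.1 7) (s.1 10) (s.1 12) (noisyDeg (s.1 1) L.degQuery ω v)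
        (noisyDeg (s.1 1) L.degQuery ω u) := by
  have hv (m : Mem) (h : m 11 = v) : (noisyDegE (cell 11)).val L ω m = _ :=
    noisyDegE_val L ω m (cell 11) (w := v) (by simp [Expr.val, h])
  have hu (m : Mem) (h : m 13 = u) : (noisyDegE (cell 13)).val L ω m = _ :=
    noisyDegE_val L ω m (cell 13) (w := u) (by simp [Expr.val, h])
  simp only [addStep, Prog.run]
  rw [hv s.1 h11]
  unfold contrib
  by_cases h1 : noisyDeg (s.1 1) L.degQuery ω v ≤ s.1 7
  · by_cases h2 : s.1 12 ≤ s.1 10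
    · have e : (cell 12).val L ω s.1 ≤ (cell 10).val L ω s.1 := by simpa [Expr.val] using h2
      have e' : (cell 7).val L ω s.1 = s.1 7 := by simp [Expr.val]
      simp only [e', h1, if_true, e, min_eq_left h2]
      rw [hu _ (by simp [h13, Expr.val])]
      by_cases h3 : noisyDeg (s.1 1) L.degQuery ω u ≤ s.1 7
      · simp +contextual [Expr.val, Function.update_apply, h8, h3]
      · simp +contextual [Expr.val, Function.update_apply, h8, h3]
    · have e : ¬ (cell 12).val L ω s.1 ≤ (cell 10).val L ω s.1 := by simpa [Expr.val] using h2
      have e' : (cell 7).val L ω s.1 = s.1 7 := by simp [Expr.val]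
      simp only [e', h1, if_true, e, min_eq_right (not_le.1 h2).le, if_false]
      rw [hu _ (by simp [h13, Expr.val])]
      by_cases h3 : noisyDeg (s.1 1) L.degQuery ω u ≤ s.1 7
      · simp +contextual [Expr.val, Function.update_apply, h8, h3]
      · simp +contextual [Expr.val, Function.update_apply, h8, h3]
  · simp +contextual [Expr.val, Function.update_apply, h8, h1]

theorem finish_run (s : Mem × ℕ) {k : ℕ} (h0 : s.1 0 = n) (h6 : s.1 6 = k) :
    (finish.run L ω s).1 0 =
      (s.1 14 + noiseScale n k (s.1 1) (s.1 10) * logit (ω 0)) / k := by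
  simp [finish, Prog.run, Expr.val, h0, h6, noiseScale, logit]

theorem thresholdLoop_run (s : Mem × ℕ) (K : ℕ) (h0 : s.1 0 = n) (h8 : s.1 8 = 0)
    (h7 : s.1 7 = 0) :
    let m := ((fun s' : Mem × ℕ => thresholdStep.run L ω (s'.1, s'.2 + 1))^[K] s).1
    (∀ a, a ≠ 7 → a ≠ 8 → a ≠ 9 → m a = s.1 a) ∧ m 8 = (K : ℕ) ∧
      m 7 = runMax (fun j => noisyDeg (s.1 1) L.degQuery ω (preVertex n ω j)) K := by
  induction K with
  | zero => simp [h7, h8, runMax]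
  | succ K ih =>
    obtain ⟨ih1, ih2, ih3⟩ := ih
    rw [Function.iterate_succ_apply']
    set s' := (fun s' : Mem × ℕ => thresholdStep.run L ω (s'.1, s'.2 + 1))^[K] s
    obtain ⟨t1, t2, t3⟩ := thresholdStep_run L ω (s'.1, s'.2 + 1) (j := K)
      (by simp [ih1, h0]) (by simpa using ih2)
    refine ⟨fun a ha hb hc => ?_, t2, ?_⟩
    · rw [t1 a ha hb hc]; exact ih1 a ha hb hc
    · rw [t3, runMax, ← ih3]
      simp only
      rw [ih1 1 (by simp) (by simp) (by simp)]

theorem sampleLoop_run (s : Mem × ℕ) (k K : ℕ) (h0 : s.1 0 = n) (h6 : s.1 6 = k)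
    (h8 : s.1 8 = 0) (h14 : s.1 14 = 0) :
    let m := ((fun s' : Mem × ℕ => (seq pickStep addStep).run L ω (s'.1, s'.2 + 1))^[K] s).1
    (∀ a, a < 8 → m a = s.1 a) ∧ m 10 = s.1 10 ∧ m 8 = (K : ℕ) ∧
      m 14 = ∑ j ∈ Finset.range K, sampleTerm n k L.degQuery (fun _ => L.nbrNat) (s.1 7) (s.1 10)
        (noisyDeg (s.1 1) L.degQuery ω) ω j := by
  induction K with
  | zero => simp [h8, h14]
  | succ K ih =>
    obtain ⟨ih1, ih2, ih3, ih4⟩ := ih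
    rw [Function.iterate_succ_apply']
    set s' := (fun s' : Mem × ℕ => (seq pickStep addStep).run L ω (s'.1, s'.2 + 1))^[K] s
    obtain ⟨t1, t2, t3, t4⟩ := pickStep_run L ω (s'.1, s'.2 + 1) (j := K) (k := k)
      (by simp [ih1, h0]) (by simp [ih1, h6]) (by simpa using ih3)
    rw [run_seq]
    set s'' := pickStep.run L ω (s'.1, s'.2 + 1)
    obtain ⟨r1, r2, r3⟩ := addStep_run L ω s'' (j := K) (v := sampleVertex n k ω K)
      (u := sampleNbr L.degQuery (fun _ => L.nbrNat) n k ω K)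
      (by rw [t1 8 (by simp) (by simp) (by simp) (by simp)]; exact ih3) t2 t4
    refine ⟨fun a ha => ?_, ?_, r2, ?_⟩
    · rw [r1 a (by omega) (by omega) (by omega) (by omega),
        t1 a (by omega) (by omega) (by omega) (by omega)]; exact ih1 a ha
    · rw [r1 10 (by simp) (by simp) (by simp) (by simp),
        t1 10 (by simp) (by simp) (by simp) (by simp)]; exact ih2
    · rw [r3, Finset.sum_range_succ, ← ih4, t1 14 (by simp) (by simp) (by simp) (by simp),
        t1 7 (by simp) (by simp) (by simp) (by simp), t1 10 (by simp) (by simp) (by simp) (by simp),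
        t1 1 (by simp) (by simp) (by simp) (by simp), t3]
      simp only [sampleTerm]
      rw [ih1 7 (by simp), ih1 1 (by simp), ih2]

theorem output_program {ε ρ : ℝ} (hρ : 0 < ρ) :
    program.output L ε ρ ω = estimateOf n ε ρ L.degQuery (fun _ => L.nbrNat)
      (noisyDeg ε L.degQuery ω) ω := by
  have hcell (q : ℕ) (m : Mem) : (cell q).val L ω m = m q := by simp [Expr.val]
  obtain ⟨a0, a1, a5, a6, a7, a8, a14⟩ := setup_run ω n L (ε := ε) hρ
  unfold Prog.output program
  simp only [run_seq, run_loop]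
  have h5 := hcell 5
  have h6 := hcell 6
  push_cast at h5 h6
  rw [h5, h6]
  set s1 := setup.run L ω (initMem n ε ρ, 0)
  rw [a5, Nat.floor_natCast]
  obtain ⟨b1, b8, b7⟩ := thresholdLoop_run L ω (s1.1, s1.2 + ((cell 5).cost + 1)) (preSize n ρ)
    a0 a8 a7
  simp only at b1 b7
  set s2 := (fun s' : Mem × ℕ => thresholdStep.run L ω (s'.1, s'.2 + 1))^[preSize n ρ]
    (s1.1, s1.2 + ((cell 5).cost + 1))
  obtain ⟨c1, c8, c10⟩ := reset_run L ω s2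
    (by rw [b1 0 (by simp) (by simp) (by simp), a0])
  set s3 := reset.run L ω s2
  have d0 : s3.1 0 = n := by
    rw [c1 0 (by simp) (by simp), b1 0 (by simp) (by simp) (by simp), a0]
  have d1 : s3.1 1 = ε := by
    rw [c1 1 (by simp) (by simp), b1 1 (by simp) (by simp) (by simp), a1]
  have d6 : s3.1 6 = sampleSize n ρ := by
    rw [c1 6 (by simp) (by simp), b1 6 (by simp) (by simp) (by simp), a6]
  have d14 : s3.1 14 = 0 := by
    rw [c1 14 (by simp) (by simp), b1 14 (by simp) (by simp) (by simp), a14]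
  have d7 : s3.1 7 = threshold n ρ (noisyDeg ε L.degQuery ω) ω := by
    rw [c1 7 (by simp) (by simp), b7, a1, threshold]
  have d10 : s3.1 10 = degCap n ε (s3.1 7) := by
    rw [c10, c1 7 (by simp) (by simp), b1 1 (by simp) (by simp) (by simp), a1]
  rw [d6, Nat.floor_natCast]
  obtain ⟨e1, e10, e8, e14⟩ := sampleLoop_run L ω (s3.1, s3.2 + ((cell 6).cost + 1))
    (sampleSize n ρ) (sampleSize n ρ) d0 d6 c8 d14
  simp only [] at e1 e10 e14
  set s4 := (fun s' : Mem × ℕ => addStep.run L ω (pickStep.run L ω (s'.1, s'.2 + 1)))^[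
    sampleSize n ρ] (s3.1, s3.2 + ((cell 6).cost + 1)) with hs4
  change (∀ a < 8, s4.1 a = s3.1 a) at e1
  change s4.1 10 = _ at e10
  change s4.1 14 = _ at e14
  rw [finish_run L ω s4 (by rw [e1 0 (by simp), d0]) (by rw [e1 6 (by simp), d6]),
    e14, e10, e1 1 (by simp), d1, d10, d7]
  rfl

/-! ### Running time -/

/-- An upper bound for the number of steps of a program without loops. -/
def stepBound : Prog → ℕ
  | .assign a e => a.cost + e.cost + 1
  | .seq p q => stepBound p + stepBound q
  | .cond a b p q => a.cost + b.cost + 1 + max (stepBound p) (stepBound q)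
  -- A junk value, excluded by `LoopFree` wherever the bound is used.
  | .loop _ _ => 0

def LoopFree : Prog → Prop
  | .assign _ _ => True
  | .seq p q => LoopFree p ∧ LoopFree q
  | .cond _ _ p q => LoopFree p ∧ LoopFree q
  | .loop _ _ => False

theorem run_le_stepBound (p : Prog) (hp : LoopFree p) (s : Mem × ℕ) :
    (p.run L ω s).2 ≤ s.2 + stepBound p := by
  induction p generalizing s with
  | assign a e => simp [Prog.run, stepBound]
  | seq p q ihp ihq =>
    have h1 := ihp hp.1 s
    have h2 := ihq hp.2 (p.run L ω s)
    simp only [Prog.run, stepBound]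
    omega
  | cond a b p q ihp ihq =>
    have h1 := ihp hp.1 (s.1, s.2 + (a.cost + b.cost + 1))
    have h2 := ihq hp.2 (s.1, s.2 + (a.cost + b.cost + 1))
    simp only [Prog.run, stepBound]
    simp only at h1 h2
    split_ifs <;> omega
  | loop k p => exact hp.elim

theorem iterate_run_le (p : Prog) (hp : LoopFree p) (K : ℕ) (s : Mem × ℕ) :
    ((fun s' : Mem × ℕ => p.run L ω (s'.1, s'.2 + 1))^[K] s).2 ≤ s.2 + K * (stepBound p + 1) := by
  induction K with
  | zero => simp
  | succ K ih =>
    rw [Function.iterate_succ_apply']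
    refine (run_le_stepBound L ω p hp _).trans ?_
    simp only
    have : (K + 1) * (stepBound p + 1) = K * (stepBound p + 1) + (stepBound p + 1) := by ring
    omega

theorem time_program_le {ε ρ : ℝ} (hρ : 0 < ρ) :
    program.time L ε ρ ω ≤ 200 + 100 * preSize n ρ + 200 * sampleSize n ρ := by
  have hcell (q : ℕ) (m : Mem) : (cell q).val L ω m = m q := by simp [Expr.val]
  obtain ⟨a0, a1, a5, a6, a7, a8, a14⟩ := setup_run ω n L (ε := ε) hρ
  have t1 := run_le_stepBound L ω setup (by simp [setup, LoopFree]) (initMem n ε ρ, 0)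
  unfold Prog.time program
  rw [run_seq, run_seq, run_seq, run_seq, run_loop, run_loop]
  have h5 := hcell 5
  have h6 := hcell 6
  push_cast at h5 h6
  rw [h5, h6]
  set s1 := setup.run L ω (initMem n ε ρ, 0)
  rw [a5, Nat.floor_natCast]
  obtain ⟨b1, b8, b7⟩ := thresholdLoop_run L ω (s1.1, s1.2 + ((cell 5).cost + 1)) (preSize n ρ)
    a0 a8 a7
  have t2 := iterate_run_le L ω thresholdStep (by simp [thresholdStep, LoopFree]) (preSize n ρ)
    (s1.1, s1.2 + ((cell 5).cost + 1))
  simp only at b1 b7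
  set s2 := (fun s' : Mem × ℕ => thresholdStep.run L ω (s'.1, s'.2 + 1))^[preSize n ρ]
    (s1.1, s1.2 + ((cell 5).cost + 1))
  obtain ⟨c1, c8, c10⟩ := reset_run L ω s2
    (by rw [b1 0 (by simp) (by simp) (by simp), a0])
  have t3 := run_le_stepBound L ω reset (by simp [reset, LoopFree]) s2
  set s3 := reset.run L ω s2
  have d6 : s3.1 6 = sampleSize n ρ := by
    rw [c1 6 (by simp) (by simp), b1 6 (by simp) (by simp) (by simp), a6]
  rw [d6, Nat.floor_natCast]
  have t4 := iterate_run_le L ω (seq pickStep addStep) (by simp [pickStep, addStep, LoopFree]) (sampleSize n ρ)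
    (s3.1, s3.2 + ((cell 6).cost + 1))
  set s4 := (fun s' : Mem × ℕ => (seq pickStep addStep).run L ω (s'.1, s'.2 + 1))^[
    sampleSize n ρ] (s3.1, s3.2 + ((cell 6).cost + 1)) with hs4
  have t5 := run_le_stepBound L ω finish (by simp [finish, LoopFree]) s4
  have u1 : stepBound setup = 56 := rfl
  have u2 : stepBound thresholdStep = 71 := rfl
  have u3 : stepBound reset = 18 := rfl
  have u4 : stepBound (seq pickStep addStep) = 130 := rfl
  have u5 : stepBound finish = 32 := rfl
  have u6 (q : ℚ) : (cell q).cost = 2 := rfl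
  simp only [u1, u2, u3, u4, u5, u6] at t1 t2 t3 t4 t5
  omega

end Estimator

/-! ### The random string -/

instance : IsProbabilityMeasure coinLaw := by unfold coinLaw; infer_instance

/-- Replace the coins with index in `I` by those of `ω'`. -/
noncomputable def mix (I : Set ℕ) (ω ω' : Coins) : Coins :=
  open Classical in fun i => if i ∈ I then ω' i else ω i

theorem mix_of_mem {I : Set ℕ} {i : ℕ} (h : i ∈ I) (ω ω' : Coins) : mix I ω ω' i = ω' i := by
  simp [mix, h]

theorem mix_of_notMem {I : Set ℕ} {i : ℕ} (h : i ∉ I) (ω ω' : Coins) : mix I ω ω' i = ω i := by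
  simp [mix, h]

theorem mix_singleton (i : ℕ) (ω ω' : Coins) : mix {i} ω ω' = Function.update ω i (ω' i) := by
  funext j
  by_cases h : j = i
  · subst h; simp [mix]
  · simp [mix, h]

theorem measurable_mix (I : Set ℕ) : Measurable fun p : Coins × Coins => mix I p.1 p.2 := by
  refine measurable_pi_lambda _ fun i => ?_
  by_cases h : i ∈ I
  · simp only [mix_of_mem h]; fun_prop
  · simp only [mix_of_notMem h]; fun_prop

/-- Preimages of cylinders split into a product of two cylinders, one for the kept coins and one for
the resampled ones. -/
theorem measurePreserving_mix (I : Set ℕ) :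
    MeasurePreserving (fun p : Coins × Coins => mix I p.1 p.2) (coinLaw.prod coinLaw) coinLaw := by
  classical
  refine ⟨measurable_mix I, ?_⟩
  refine Measure.eq_infinitePi _ fun s t ht => ?_
  rw [Measure.map_apply (measurable_mix I) (.pi s.countable_toSet fun i _ => ht i)]
  have : (fun p : Coins × Coins => mix I p.1 p.2) ⁻¹' (s : Set ℕ).pi t =
      ((s.filter (· ∉ I) : Finset ℕ) : Set ℕ).pi t ×ˢ
        ((s.filter (· ∈ I) : Finset ℕ) : Set ℕ).pi t := by
    ext ⟨ω, ω'⟩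
    simp only [Set.mem_preimage, Set.mem_pi, Finset.mem_coe, Set.mem_prod, Finset.mem_filter]
    constructor
    · intro h
      exact ⟨fun i hi => by simpa [mix_of_notMem hi.2] using h i hi.1,
        fun i hi => by simpa [mix_of_mem hi.2] using h i hi.1⟩
    · rintro ⟨h1, h2⟩ i hi
      by_cases hI : i ∈ I
      · simpa [mix_of_mem hI] using h2 i ⟨hi, hI⟩
      · simpa [mix_of_notMem hI] using h1 i ⟨hi, hI⟩
  rw [this, Measure.prod_prod]
  unfold coinLaw
  rw [Measure.infinitePi_pi _ fun i _ => ht i, Measure.infinitePi_pi _ fun i _ => ht i, mul_comm,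
    Finset.prod_filter_mul_prod_filter_not]

theorem coinLaw_eq_lintegral_mix (I : Set ℕ) {A : Set Coins} (hA : MeasurableSet A) :
    coinLaw A = ∫⁻ ω, coinLaw {ω' | mix I ω ω' ∈ A} ∂coinLaw := by
  rw [← (measurePreserving_mix I).measure_preimage hA.nullMeasurableSet,
    Measure.prod_apply (measurable_mix I hA)]
  rfl

/-- Fubini as a conditioning principle: two events may be compared with all coins outside `I`
frozen. -/
theorem coinLaw_le_mul_of_mix (I : Set ℕ) {A B : Set Coins} (hA : MeasurableSet A)
    (hB : MeasurableSet B) (c : ℝ≥0∞)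
    (h : ∀ ω, coinLaw {ω' | mix I ω ω' ∈ A} ≤ c * coinLaw {ω' | mix I ω ω' ∈ B}) :
    coinLaw A ≤ c * coinLaw B := by
  rw [coinLaw_eq_lintegral_mix I hA, coinLaw_eq_lintegral_mix I hB, ← lintegral_const_mul]
  · exact lintegral_mono h
  · exact measurable_measure_prodMk_left (measurable_mix I hB)

theorem coinLaw_le_of_mix (I : Set ℕ) {A : Set Coins} (hA : MeasurableSet A) (c : ℝ≥0∞)
    (h : ∀ ω, coinLaw {ω' | mix I ω ω' ∈ A} ≤ c) : coinLaw A ≤ c := by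
  simpa using coinLaw_le_mul_of_mix I hA .univ c (by simpa using h)

theorem measurePreserving_coin (i : ℕ) :
    MeasurePreserving (fun ω : Coins => ω i) coinLaw volume :=
  measurePreserving_eval_infinitePi (fun _ : ℕ => (volume : Measure unitInterval)) i

theorem coinLaw_update (i : ℕ) (ω : Coins) {A : Set Coins} (hA : MeasurableSet A) :
    coinLaw {ω' | mix {i} ω ω' ∈ A} =
      (volume : Measure unitInterval) {x | Function.update ω i x ∈ A} := by
  simp only [mix_singleton]
  exact (measurePreserving_coin i).measure_preimage
    ((measurable_update ω) hA).nullMeasurableSet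

theorem coinLaw_le_mul_of_update (i : ℕ) {A B : Set Coins} (hA : MeasurableSet A)
    (hB : MeasurableSet B) (c : ℝ≥0∞)
    (h : ∀ ω, (volume : Measure unitInterval) {x | Function.update ω i x ∈ A} ≤
      c * (volume : Measure unitInterval) {x | Function.update ω i x ∈ B}) :
    coinLaw A ≤ c * coinLaw B :=
  coinLaw_le_mul_of_mix {i} hA hB c fun ω => by
    rw [coinLaw_update i ω hA, coinLaw_update i ω hB]; exact h ω

theorem integral_coinLaw_update (i : ℕ) {f : Coins → ℝ} (hf : Measurable f)
    (hi : Integrable f coinLaw) :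
    ∫ ω, f ω ∂coinLaw = ∫ ω, (∫ x : unitInterval, f (Function.update ω i x)) ∂coinLaw := by
  have h := measurePreserving_mix {i}
  have e : ∫ ω, f ω ∂coinLaw = ∫ p : Coins × Coins, f (mix {i} p.1 p.2) ∂coinLaw.prod coinLaw := by
    conv_lhs => rw [← h.map_eq]
    exact integral_map h.measurable.aemeasurable hf.aestronglyMeasurable
  rw [e, integral_prod (fun p : Coins × Coins => f (mix {i} p.1 p.2))
    ((h.integrable_comp hf.aestronglyMeasurable).2 hi)]
  refine integral_congr_ae (.of_forall fun ω => ?_)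
  simp only [mix_singleton]
  rw [← (measurePreserving_coin i).map_eq]
  exact (integral_map (φ := fun ω : Coins => ω i) (measurePreserving_coin i).aemeasurable
    (hf.comp (measurable_update ω)).aestronglyMeasurable).symm

/-! ### Logistic noise -/

/-- The map of `[0, 1]` that shifts `logit` by `log a`. -/
noncomputable def logitShift (a x : ℝ) : ℝ := a * x / (1 - x + a * x)

/-- Both denominators in the difference quotient are at least min(1, a), and a / min(1, a)² = exp
|log a|. -/
theorem lipschitzOnWith_logitShift (r : ℝ) :
    LipschitzOnWith (Real.exp |r|).toNNReal (logitShift (Real.exp r)) (Set.Icc 0 1) := by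
  refine LipschitzOnWith.of_dist_le_mul fun x hx y hy => ?_
  rw [Real.coe_toNNReal _ (Real.exp_pos _).le, Real.dist_eq, Real.dist_eq]
  have ha := Real.exp_pos r
  set a := Real.exp r with hadef
  have hmin : ∀ z ∈ Set.Icc (0 : ℝ) 1, min 1 a ≤ 1 - z + a * z := by
    intro z hz
    rcases le_total 1 a with h | h
    · rw [min_eq_left h]; nlinarith [hz.1]
    · rw [min_eq_right h]; nlinarith [hz.2]
  have hm : 0 < min 1 a := lt_min one_pos ha
  have hX := hm.trans_le (hmin x hx)
  have hY := hm.trans_le (hmin y hy)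
  have e : logitShift a x - logitShift a y = a / ((1 - x + a * x) * (1 - y + a * y)) * (x - y) := by
    unfold logitShift
    field_simp
    ring
  have hb : a / ((1 - x + a * x) * (1 - y + a * y)) ≤ Real.exp |r| := by
    rw [div_le_iff₀ (mul_pos hX hY)]
    have h1 : min 1 a * min 1 a ≤ (1 - x + a * x) * (1 - y + a * y) :=
      mul_le_mul (hmin x hx) (hmin y hy) hm.le hX.le
    have h2 : a ≤ Real.exp |r| * (min 1 a * min 1 a) := by
      rcases le_total 0 r with h | h
      · rw [abs_of_nonneg h, min_eq_left (Real.one_le_exp h)]; simp [a]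
      · rw [abs_of_nonpos h, min_eq_right (Real.exp_le_one_iff.2 h), hadef, ← Real.exp_add,
          ← Real.exp_add]
        apply le_of_eq; congr 1; ring
    exact h2.trans (mul_le_mul_of_nonneg_left h1 (Real.exp_pos _).le)
  rw [e, abs_mul, abs_of_pos (div_pos ha (mul_pos hX hY))]
  exact mul_le_mul_of_nonneg_right hb (abs_nonneg _)

theorem logit_logitShift (r : ℝ) {x : ℝ} (hx : x ∈ Set.Ioo (0 : ℝ) 1) :
    logit (logitShift (Real.exp r) x) = r + logit x := by
  have h0 := hx.1
  have h1 : 0 < 1 - x := sub_pos.2 hx.2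
  have ha := Real.exp_pos r
  have : logitShift (Real.exp r) x / (1 - logitShift (Real.exp r) x) =
      Real.exp r * (x / (1 - x)) := by
    unfold logitShift
    have : 0 < 1 - x + Real.exp r * x := by positivity
    have e : 1 - Real.exp r * x / (1 - x + Real.exp r * x) = (1 - x) / (1 - x + Real.exp r * x) := by
      field_simp; ring
    rw [e]
    field_simp
  rw [logit, this, Real.log_mul ha.ne' (div_pos h0 h1).ne', Real.log_exp, logit]

theorem logitShift_mem_Ioo (r : ℝ) {x : ℝ} (hx : x ∈ Set.Ioo (0 : ℝ) 1) :
    logitShift (Real.exp r) x ∈ Set.Ioo (0 : ℝ) 1 := by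
  have h0 := hx.1
  have h1 : 0 < 1 - x := sub_pos.2 hx.2
  have : 0 < Real.exp r * x := by positivity
  have : 0 < 1 - x + Real.exp r * x := by positivity
  unfold logitShift
  refine ⟨by positivity, ?_⟩
  rw [div_lt_one this]; linarith

theorem logitShift_neg (r : ℝ) {x : ℝ} (hx : x ∈ Set.Ioo (0 : ℝ) 1) :
    logitShift (Real.exp (-r)) (logitShift (Real.exp r) x) = x := by
  have h0 := hx.1
  have h1 : 0 < 1 - x := sub_pos.2 hx.2
  have h2 := Real.exp_pos r
  have h3 : 0 < 1 - x + Real.exp r * x := by positivity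
  have e : 1 - Real.exp r * x / (1 - x + Real.exp r * x) = (1 - x) / (1 - x + Real.exp r * x) := by
    field_simp; ring
  unfold logitShift
  rw [e, Real.exp_neg]
  field_simp
  ring

/-- The endpoints, where `logit` takes junk values, form a null set. -/
theorem volume_Ioo_inter (A : Set unitInterval) :
    volume A = volume ((↑) '' A ∩ Set.Ioo (0 : ℝ) 1) := by
  rw [unitInterval.volume_apply]
  apply measure_congr
  have h : ∀ᵐ x : ℝ, x ≠ 0 ∧ x ≠ 1 :=
    (Measure.ae_ne volume 0).and (Measure.ae_ne volume 1)
  filter_upwards [h] with x hx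
  apply propext
  constructor
  · rintro ⟨y, hy, rfl⟩
    exact ⟨⟨y, hy, rfl⟩, lt_of_le_of_ne y.2.1 hx.1.symm, lt_of_le_of_ne y.2.2 hx.2⟩
  · exact fun h => h.1

/-- Logistic noise hides a shift: moving the center by at most `c` times the scale changes
probabilities by at most a factor `exp c`. -/
theorem volume_logit_le (Q : ℝ → Prop) {s s' b c : ℝ} (hb : 0 < b) (h : |s - s'| ≤ c * b) :
    (volume : Measure unitInterval) {x | Q (s + b * logit x)} ≤
      ENNReal.ofReal (Real.exp c) * (volume : Measure unitInterval) {x | Q (s' + b * logit x)} := by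
  rw [volume_Ioo_inter {x | Q (s + b * logit x)}, volume_Ioo_inter {x | Q (s' + b * logit x)}]
  set r := (s - s') / b with hr
  have hrc : |r| ≤ c := by rw [hr, abs_div, abs_of_pos hb, div_le_iff₀ hb]; exact h
  set B := ((↑) '' {x : unitInterval | Q (s' + b * logit x)} ∩ Set.Ioo (0 : ℝ) 1)
  -- Shifting the center by `s - s'` amounts to applying the shift map to the uniform sample, so one
  -- event lies in a Lipschitz image of the other.
  have hsub : ((↑) '' {x : unitInterval | Q (s + b * logit x)} ∩ Set.Ioo (0 : ℝ) 1) ⊆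
      logitShift (Real.exp (-r)) '' B := by
    rintro _ ⟨⟨x, hx, rfl⟩, hx'⟩
    have hm := logitShift_mem_Ioo r hx'
    refine ⟨logitShift (Real.exp r) x, ⟨⟨⟨_, hm.1.le, hm.2.le⟩, ?_, rfl⟩, hm⟩,
      logitShift_neg r hx'⟩
    have : s' + b * (r + logit x) = s + b * logit x := by rw [hr]; field_simp; ring
    simpa [logit_logitShift r hx', this] using hx
  refine (measure_mono hsub).trans ?_
  -- One-dimensional Hausdorff measure is Lebesgue measure, and its behavior under Lipschitz maps
  -- needs no measurability of `Q`.
  have hl := ((lipschitzOnWith_logitShift (-r)).mono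
    (fun x (hx : x ∈ B) => Set.Ioo_subset_Icc_self hx.2)).hausdorffMeasure_image_le zero_le_one
  rw [hausdorffMeasure_real, ENNReal.rpow_one] at hl
  refine hl.trans (mul_le_mul_left (ENNReal.ofReal_le_ofReal ?_) _)
  rw [abs_neg]
  exact Real.exp_le_exp.2 hrc

/-- A large value of |logit x| forces `x` to lie within exp(-t) of an endpoint. -/
theorem volume_lt_abs_logit_le (t : ℝ) :
    (volume : Measure unitInterval) {x | t < |logit x|} ≤ ENNReal.ofReal (2 * Real.exp (-t)) := by
  rw [volume_Ioo_inter]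
  have hsub : ((↑) '' {x : unitInterval | t < |logit x|} ∩ Set.Ioo (0 : ℝ) 1) ⊆
      Set.Icc 0 (Real.exp (-t)) ∪ Set.Icc (1 - Real.exp (-t)) 1 := by
    rintro _ ⟨⟨x, hx, rfl⟩, hx'⟩
    have h1 : 0 < 1 - (x : ℝ) := sub_pos.2 hx'.2
    have hp : 0 < (x : ℝ) / (1 - x) := div_pos hx'.1 h1
    rcases lt_abs.1 (show t < |logit x| from hx) with h | h
    · right
      have h2 := (Real.lt_log_iff_exp_lt hp).1 h
      rw [lt_div_iff₀ h1] at h2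
      refine ⟨?_, hx'.2.le⟩
      have : Real.exp (-t) * Real.exp t = 1 := by rw [← Real.exp_add]; simp
      nlinarith [Real.exp_pos (-t), Real.exp_pos t, hx'.2]
    · left
      have h2 : logit x < -t := by linarith
      have h2 := (Real.log_lt_iff_lt_exp hp).1 h2
      rw [div_lt_iff₀ h1] at h2
      exact ⟨hx'.1.le, by nlinarith [Real.exp_pos (-t), hx'.1]⟩
  refine (measure_mono hsub).trans ((measure_union_le _ _).trans ?_)
  rw [Real.volume_Icc, Real.volume_Icc, ← ENNReal.ofReal_add (by simp [Real.exp_nonneg])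
    (by simp [Real.exp_nonneg])]
  apply ENNReal.ofReal_le_ofReal
  linarith

theorem measurable_logit : Measurable logit := by unfold logit; fun_prop

/-! ### Rounded uniform samples -/

theorem integral_floor (g : ℕ → ℝ) (n : ℕ) :
    (∀ v < n, IntervalIntegrable (fun y : ℝ => g ⌊y⌋₊) volume v (v + 1 : ℕ)) ∧
      ∫ y in (0 : ℝ)..n, g ⌊y⌋₊ = ∑ v ∈ Finset.range n, g v := by
  have hae (v : ℕ) : ∀ᵐ y : ℝ, y ∈ Set.uIoc (v : ℝ) (v + 1 : ℕ) → g ⌊y⌋₊ = g v := by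
    filter_upwards [Measure.ae_ne volume ((v + 1 : ℕ) : ℝ)] with y hy hm
    rw [Set.uIoc_of_le (by push_cast; linarith)] at hm
    have : ⌊y⌋₊ = v := by
      rw [Nat.floor_eq_iff (by have := hm.1; have : (0 : ℝ) ≤ v := by positivity
                               linarith)]
      exact ⟨hm.1.le, by have := lt_of_le_of_ne hm.2 hy; push_cast at this; exact this⟩
    rw [this]
  have hint : ∀ v < n, IntervalIntegrable (fun y : ℝ => g ⌊y⌋₊) volume v (v + 1 : ℕ) := by
    intro v _
    refine (intervalIntegrable_const (c := g v)).congr_ae ?_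
    rw [Filter.EventuallyEq, ae_restrict_iff' measurableSet_uIoc]
    filter_upwards [hae v] with y hy hm
    exact (hy hm).symm
  refine ⟨hint, ?_⟩
  have := intervalIntegral.sum_integral_adjacent_intervals (a := fun v : ℕ => (v : ℝ)) hint
  rw [Nat.cast_zero] at this
  rw [← this]
  refine Finset.sum_congr rfl fun v _ => ?_
  rw [intervalIntegral.integral_congr_ae (g := fun _ => g v) (hae v)]
  simp

theorem integral_unitInterval (f : ℝ → ℝ) :
    ∫ x : unitInterval, f x = ∫ x in (0 : ℝ)..1, f x := by
  rw [intervalIntegral.integral_of_le zero_le_one, ← integral_Icc_eq_integral_Ioc]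
  exact unitInterval.measurePreserving_coe.integral_comp unitInterval.measurableEmbedding_coe f

/-- Stratified sampling: if one point is sampled in each of `k` strata of `[0, n)`, then the rounded
points are uniform on average. -/
theorem sum_integral_stratified (g : ℕ → ℝ) {n k : ℕ} (hn : 0 < n) (hk : 0 < k) :
    ∑ j ∈ Finset.range k, ∫ x : unitInterval, g ⌊((j : ℝ) + x) * ((n : ℝ) / k)⌋₊ =
      k / n * ∑ v ∈ Finset.range n, g v := by
  have hc : ((n : ℝ) / k) ≠ 0 := by positivity
  have h0 := (integral_floor g n)
  have hint : IntervalIntegrable (fun y : ℝ => g ⌊y⌋₊) volume 0 n := by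
    have := IntervalIntegrable.trans_iterate h0.1
    simpa using this
  -- A linear substitution turns the integral over stratum `j` into one over a piece of [0, n]; the
  -- pieces are adjacent and add up.
  have h1 (j : ℕ) : ∫ x : unitInterval, g ⌊((j : ℝ) + x) * ((n : ℝ) / k)⌋₊ =
      (k / n) * ∫ y in (j * ((n : ℝ) / k))..((j + 1 : ℕ) * ((n : ℝ) / k)), g ⌊y⌋₊ := by
    rw [integral_unitInterval (fun x => g ⌊((j : ℝ) + x) * ((n : ℝ) / k)⌋₊)]
    have := intervalIntegral.integral_comp_mul_add (fun y : ℝ => g ⌊y⌋₊) hc (j * ((n : ℝ) / k))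
      (a := 0) (b := 1)
    rw [smul_eq_mul, inv_div] at this
    convert this using 2
    · funext x; congr 2; ring
    · congr 1 <;> push_cast <;> ring
  simp_rw [h1]
  rw [← Finset.mul_sum]
  have := intervalIntegral.sum_integral_adjacent_intervals (n := k) (f := fun y : ℝ => g ⌊y⌋₊)
    (μ := volume) (a := fun j : ℕ => (j : ℝ) * ((n : ℝ) / k)) ?_
  · rw [this]
    have e : (k : ℝ) * ((n : ℝ) / k) = n := by field_simp
    simp only [e, Nat.cast_zero, zero_mul, h0.2]
  · intro j hj
    have h2 : ((j + 1 : ℕ) : ℝ) * ((n : ℝ) / k) ≤ n := by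
      have : ((j + 1 : ℕ) : ℝ) ≤ k := by exact_mod_cast hj
      calc _ ≤ (k : ℝ) * ((n : ℝ) / k) := by gcongr
        _ = n := by field_simp
    have h3 : (0 : ℝ) ≤ (j : ℝ) * ((n : ℝ) / k) := by positivity
    have h4 : (j : ℝ) * ((n : ℝ) / k) ≤ ((j + 1 : ℕ) : ℝ) * ((n : ℝ) / k) := by gcongr; simp
    refine hint.mono_set ?_
    rw [Set.uIcc_of_le h4, Set.uIcc_of_le (by positivity)]
    exact Set.Icc_subset_Icc h3 h2

theorem integral_floor_mul (g : ℕ → ℝ) {d : ℕ} (hd : 0 < d) :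
    ∫ x : unitInterval, g ⌊(x : ℝ) * d⌋₊ = (∑ i ∈ Finset.range d, g i) / d := by
  have := sum_integral_stratified g hd one_pos
  simp only [Finset.sum_range_one, Nat.cast_zero, zero_add, Nat.cast_one, div_one] at this
  rw [this]; ring

theorem volume_floor_mul (Q : ℕ → Prop) [DecidablePred Q] {d : ℕ} (hd : 0 < d) :
    (volume : Measure unitInterval) {x | Q ⌊(x : ℝ) * d⌋₊} =
      ENNReal.ofReal (((Finset.range d).filter Q).card / d) := by
  have hm : MeasurableSet {x : unitInterval | Q ⌊(x : ℝ) * d⌋₊} :=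
    (Nat.measurable_floor.comp (measurable_subtype_coe.mul_const _)) (MeasurableSet.of_discrete (s := {i | Q i}))
  have h1 := integral_floor_mul (fun i => if Q i then 1 else 0) hd
  have h2 : (fun x : unitInterval => if Q ⌊(x : ℝ) * d⌋₊ then (1 : ℝ) else 0) =
      Set.indicator {x : unitInterval | Q ⌊(x : ℝ) * d⌋₊} 1 := by
    funext x; simp [Set.indicator_apply]
  rw [h2, integral_indicator_one hm, Finset.sum_boole] at h1
  rw [← h1, ofReal_measureReal]

/-! ### Measurability of the estimator -/

theorem measurable_apply_nat {N : Coins → ℕ} (hN : Measurable N) {F : Coins → ℕ → ℝ}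
    (hF : ∀ v, Measurable fun ω => F ω v) : Measurable fun ω => F ω (N ω) :=
  (measurable_from_prod_countable_right (f := fun p : ℕ × Coins => F p.2 p.1) hF).comp
    (hN.prodMk measurable_id)

theorem measurable_noisyDeg (ε : ℝ) (dg : ℕ → ℝ) (v : ℕ) :
    Measurable fun ω => noisyDeg ε dg ω v := by
  unfold noisyDeg
  have := measurable_logit
  fun_prop

theorem measurable_preVertex (n j : ℕ) : Measurable fun ω => preVertex n ω j := by
  unfold preVertex; fun_prop

theorem measurable_sampleVertex (n k j : ℕ) : Measurable fun ω => sampleVertex n k ω j := by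
  unfold sampleVertex; fun_prop

theorem measurable_sampleNbr (d : ℕ → ℝ) (nb : ℕ → ℕ → ℕ → ℕ) (n k j : ℕ) :
    Measurable fun ω => sampleNbr d nb n k ω j := by
  unfold sampleNbr
  have h (v : ℕ) : Measurable fun ω : Coins => nb j v ⌊(ω (4 * j + 3) : ℝ) * d v⌋₊ :=
    Measurable.comp (Measurable.of_discrete (f := nb j v)) (by fun_prop)
  exact (measurable_from_prod_countable_right
    (f := fun p : ℕ × Coins => nb j p.1 ⌊(p.2 (4 * j + 3) : ℝ) * d p.1⌋₊) h).comp
    ((measurable_sampleVertex n k j).prodMk measurable_id)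

theorem measurable_runMax {F : Coins → ℕ → ℝ} (hF : ∀ j, Measurable fun ω => F ω j) (K : ℕ) :
    Measurable fun ω => runMax (F ω) K := by
  induction K with
  | zero => exact measurable_const
  | succ K ih => exact ih.max (hF K)

theorem measurable_threshold (n : ℕ) (ρ : ℝ) {D : Coins → ℕ → ℝ}
    (hD : ∀ v, Measurable fun ω => D ω v) : Measurable fun ω => threshold n ρ (D ω) ω :=
  measurable_runMax (fun j => measurable_apply_nat (measurable_preVertex n j) hD) _

theorem measurable_sampleTerm (n k : ℕ) (d : ℕ → ℝ) (nb : ℕ → ℕ → ℕ → ℕ) {T cap : Coins → ℝ}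
    (hT : Measurable T) (hcap : Measurable cap) {D : Coins → ℕ → ℝ}
    (hD : ∀ v, Measurable fun ω => D ω v) (j : ℕ) :
    Measurable fun ω => sampleTerm n k d nb (T ω) (cap ω) (D ω) ω j := by
  unfold sampleTerm contrib
  have hv := measurable_apply_nat (measurable_sampleVertex n k j) hD
  have hu := measurable_apply_nat (measurable_sampleNbr d nb n k j) hD
  have hd : Measurable fun ω => d (sampleVertex n k ω j) :=
    measurable_apply_nat (measurable_sampleVertex n k j) (F := fun _ => d)
      (fun _ => measurable_const)
  exact Measurable.ite (measurableSet_le hv hT)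
    (Measurable.ite (measurableSet_le hu hT) (hd.min hcap) ((hd.min hcap).const_mul 2))
    measurable_const

theorem measurable_sampleSum (n k : ℕ) (d : ℕ → ℝ) (nb : ℕ → ℕ → ℕ → ℕ) {T cap : Coins → ℝ}
    (hT : Measurable T) (hcap : Measurable cap) {D : Coins → ℕ → ℝ}
    (hD : ∀ v, Measurable fun ω => D ω v) :
    Measurable fun ω => sampleSum n k d nb (T ω) (cap ω) (D ω) ω := by
  unfold sampleSum
  exact Finset.measurable_sum _ fun j _ => measurable_sampleTerm n k d nb hT hcap hD j

theorem measurable_estimateOf (n : ℕ) (ε ρ : ℝ) (d : ℕ → ℝ) (nb : ℕ → ℕ → ℕ → ℕ)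
    {D : Coins → ℕ → ℝ} (hD : ∀ v, Measurable fun ω => D ω v) :
    Measurable fun ω => estimateOf n ε ρ d nb (D ω) ω := by
  have hT := measurable_threshold n ρ hD
  have hcap : Measurable fun ω => degCap n ε (threshold n ρ (D ω) ω) := by
    unfold degCap; fun_prop
  have hs := measurable_sampleSum n (sampleSize n ρ) d nb hT hcap hD
  have := measurable_logit
  unfold estimateOf noiseScale
  fun_prop

/-! ### Dependence of the estimator on single coins -/

theorem noisyDeg_update (ε : ℝ) (dg : ℕ → ℝ) (ω : Coins) {i : ℕ} (hi : ∀ v, 4 * v + 4 ≠ i)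
    (x : unitInterval) : noisyDeg ε dg (Function.update ω i x) = noisyDeg ε dg ω := by
  funext v; simp [noisyDeg, Function.update_of_ne (hi v)]

theorem threshold_congr (n : ℕ) (ρ : ℝ) (D : ℕ → ℝ) {ω ω' : Coins}
    (h : ∀ j, ω' (4 * j + 1) = ω (4 * j + 1)) :
    threshold n ρ D ω' = threshold n ρ D ω := by
  have : preVertex n ω' = preVertex n ω := by funext j; simp [preVertex, h]
  rw [threshold, threshold, this]

theorem sampleVertex_congr (n k : ℕ) {ω ω' : Coins} (h : ∀ j, ω' (4 * j + 2) = ω (4 * j + 2)) :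
    sampleVertex n k ω' = sampleVertex n k ω := by
  funext j; simp [sampleVertex, h]

theorem sampleNbr_congr (d : ℕ → ℝ) (nb : ℕ → ℕ → ℕ → ℕ) (n k : ℕ) {ω ω' : Coins}
    (h : ∀ j, ω' (4 * j + 2) = ω (4 * j + 2)) (h' : ∀ j, ω' (4 * j + 3) = ω (4 * j + 3)) :
    sampleNbr d nb n k ω' = sampleNbr d nb n k ω := by
  funext j; simp [sampleNbr, sampleVertex_congr n k h, h']

theorem sampleSum_congr (n k : ℕ) (d : ℕ → ℝ) (nb : ℕ → ℕ → ℕ → ℕ) (T cap : ℝ) (D : ℕ → ℝ)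
    {ω ω' : Coins}
    (h : ∀ j, ω' (4 * j + 2) = ω (4 * j + 2)) (h' : ∀ j, ω' (4 * j + 3) = ω (4 * j + 3)) :
    sampleSum n k d nb T cap D ω' = sampleSum n k d nb T cap D ω := by
  simp [sampleSum, sampleTerm, sampleVertex_congr n k h, sampleNbr_congr d nb n k h h']

/-- Once the noisy degrees are fixed, the coins that produced them are not read again. -/
theorem estimateOf_update (n : ℕ) (ε ρ : ℝ) (d : ℕ → ℝ) (nb : ℕ → ℕ → ℕ → ℕ) (D : ℕ → ℝ)
    (ω : Coins) (a : ℕ) (x : unitInterval) :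
    estimateOf n ε ρ d nb D (Function.update ω (4 * a + 4) x) = estimateOf n ε ρ d nb D ω := by
  have h (i : ℕ) (hi : i ≠ 4 * a + 4) : Function.update ω (4 * a + 4) x i = ω i :=
    Function.update_of_ne hi _ _
  rw [estimateOf, threshold_congr n ρ D fun j => h _ (by omega),
    sampleSum_congr n _ d nb _ _ D (fun j => h _ (by omega)) (fun j => h _ (by omega)),
    h 0 (by omega), ← estimateOf]

/-! ### Invariance under the order of the adjacency lists -/

/-- Hybrid argument: the oracle is exchanged for one sample at a time. The coin 4i + 3 affects only
the neighbor in sample `i`, whose conditional law is the same for both oracles. -/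
theorem coinLaw_estimateOf_eq (n : ℕ) (ε ρ : ℝ) (d dg : ℕ → ℝ) (nb nb' : ℕ → ℕ → ℕ)
    (h : ∀ v (Q : ℕ → Prop), (volume : Measure unitInterval) {x | Q (nb v ⌊(x : ℝ) * d v⌋₊)} =
      (volume : Measure unitInterval) {x | Q (nb' v ⌊(x : ℝ) * d v⌋₊)})
    {S : Set ℝ} (hS : MeasurableSet S) :
    coinLaw {ω | estimateOf n ε ρ d (fun _ => nb) (noisyDeg ε dg ω) ω ∈ S} ≤
      coinLaw {ω | estimateOf n ε ρ d (fun _ => nb') (noisyDeg ε dg ω) ω ∈ S} := by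
  let hyb (i : ℕ) : ℕ → ℕ → ℕ → ℕ := fun j => if j < i then nb' else nb
  have hD := measurable_noisyDeg ε dg
  have step (i : ℕ) : coinLaw {ω | estimateOf n ε ρ d (hyb i) (noisyDeg ε dg ω) ω ∈ S} ≤
      coinLaw {ω | estimateOf n ε ρ d (hyb (i + 1)) (noisyDeg ε dg ω) ω ∈ S} := by
    rw [← one_mul (coinLaw {ω | estimateOf n ε ρ d (hyb (i + 1)) (noisyDeg ε dg ω) ω ∈ S})]
    refine coinLaw_le_mul_of_update (4 * i + 3) (measurable_estimateOf n ε ρ d _ hD hS)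
      (measurable_estimateOf n ε ρ d _ hD hS) 1 fun ω => ?_
    rw [one_mul]
    set k := sampleSize n ρ with hk
    set D := noisyDeg ε dg ω
    set T := threshold n ρ D ω
    -- The estimate as a function of the neighbor `u` in sample `i`, everything else being frozen.
    let Ψ (u : ℕ) : ℝ := (∑ j ∈ Finset.range k, contrib T (degCap n ε T)
        (d (sampleVertex n k ω j)) (D (sampleVertex n k ω j))
        (D (Function.update (sampleNbr d (hyb i) n k ω) i u j))
      + noiseScale n k ε (degCap n ε T) * logit (ω 0)) / k
    have key (nb₀ : ℕ → ℕ → ℕ → ℕ) (x : unitInterval) (h0 : ∀ j, j ≠ i → nb₀ j = hyb i j) :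
        estimateOf n ε ρ d nb₀ (noisyDeg ε dg (Function.update ω (4 * i + 3) x))
          (Function.update ω (4 * i + 3) x) =
        Ψ (nb₀ i (sampleVertex n k ω i) ⌊(x : ℝ) * d (sampleVertex n k ω i)⌋₊) := by
      have hu (m : ℕ) (hm : m ≠ 4 * i + 3) : Function.update ω (4 * i + 3) x m = ω m :=
        Function.update_of_ne hm _ _
      have hv := sampleVertex_congr n k (ω' := Function.update ω (4 * i + 3) x)
        fun j => hu _ (by omega)
      have hn : sampleNbr d nb₀ n k (Function.update ω (4 * i + 3) x) =
          Function.update (sampleNbr d (hyb i) n k ω) i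
            (nb₀ i (sampleVertex n k ω i) ⌊(x : ℝ) * d (sampleVertex n k ω i)⌋₊) := by
        funext j
        by_cases hj : j = i
        · subst hj; simp [sampleNbr, hv]
        · rw [Function.update_of_ne hj, sampleNbr, sampleNbr, hv, hu _ (by omega), h0 j hj]
      rw [noisyDeg_update ε dg ω (by omega), estimateOf,
        threshold_congr n ρ _ fun j => hu _ (by omega), hu 0 (by omega)]
      simp only [sampleSum, sampleTerm, ← hk, hv, hn]
      rfl
    simp only [Set.mem_preimage]
    have e1 := fun x => key (hyb i) x (fun _ _ => rfl)
    have e2 := fun x => key (hyb (i + 1)) x (fun j hj => by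
      have : j < i + 1 ↔ j < i := by omega
      simp [hyb, this])
    simp only [e1, e2]
    simp only [hyb, lt_irrefl, if_false, Nat.lt_succ_self, if_true]
    exact (h _ (fun u => Ψ u ∈ S)).le
  have all (i : ℕ) : coinLaw {ω | estimateOf n ε ρ d (hyb 0) (noisyDeg ε dg ω) ω ∈ S} ≤
      coinLaw {ω | estimateOf n ε ρ d (hyb i) (noisyDeg ε dg ω) ω ∈ S} := by
    induction i with
    | zero => exact le_rfl
    | succ i ih => exact ih.trans (step i)
  have h0 : hyb 0 = fun _ => nb := by funext j; simp [hyb]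
  have h1 : ∀ D ω, estimateOf n ε ρ d (hyb (sampleSize n ρ)) D ω =
      estimateOf n ε ρ d (fun _ => nb') D ω := by
    intro D ω
    have : ∀ T cap, sampleSum n (sampleSize n ρ) d (hyb (sampleSize n ρ)) T cap D ω =
        sampleSum n (sampleSize n ρ) d (fun _ => nb') T cap D ω := by
      intro T cap
      refine Finset.sum_congr rfl fun j hj => ?_
      simp [sampleTerm, sampleNbr, hyb, Finset.mem_range.1 hj]
    simp only [estimateOf, this]
  have := all (sampleSize n ρ)
  simp only [h1, h0] at this
  exact this

/-! ### Privacy of the noisy degrees -/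

/-- With the other coins frozen, only the noisy degree of `a` moves. A shift by at most 1 is ε/4
times the scale 4/ε, and everything downstream is postprocessing. -/
theorem coinLaw_estimateOf_le_of_noisyDeg (n : ℕ) {ε : ℝ} (hε : 0 < ε) (ρ : ℝ) (d dg : ℕ → ℝ)
    (nb : ℕ → ℕ → ℕ → ℕ) (a : ℕ) {t : ℝ} (ht : |dg a - t| ≤ 1) {S : Set ℝ}
    (hS : MeasurableSet S) :
    coinLaw {ω | estimateOf n ε ρ d nb (noisyDeg ε dg ω) ω ∈ S} ≤
      ENNReal.ofReal (Real.exp (ε / 4)) *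
        coinLaw {ω | estimateOf n ε ρ d nb (noisyDeg ε (Function.update dg a t) ω) ω ∈ S} := by
  refine coinLaw_le_mul_of_update (4 * a + 4)
    (measurable_estimateOf n ε ρ d _ (measurable_noisyDeg ε dg) hS)
    (measurable_estimateOf n ε ρ d _ (measurable_noisyDeg ε _) hS) _ fun ω => ?_
  have e (dg' : ℕ → ℝ) (h : ∀ v, v ≠ a → dg' v = dg v) (x : unitInterval) :
      noisyDeg ε dg' (Function.update ω (4 * a + 4) x) =
        Function.update (noisyDeg ε dg ω) a (dg' a + 4 / ε * logit x) := by
    funext v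
    by_cases hv : v = a
    · subst hv; simp [noisyDeg]
    · have : 4 * v + 4 ≠ 4 * a + 4 := by omega
      simp [noisyDeg, hv, h v hv]
  simp only [Set.mem_preimage, estimateOf_update, e dg (fun _ _ => rfl),
    e (Function.update dg a t) (fun v hv => Function.update_of_ne hv _ _), Function.update_self]
  refine volume_logit_le (fun y => estimateOf n ε ρ d nb
    (Function.update (noisyDeg ε dg ω) a y) ω ∈ S) (by positivity) ?_
  have : ε / 4 * (4 / ε) = 1 := by field_simp
  rw [this]; exact ht

/-! ### Privacy of the sampled degrees and neighbors -/

theorem runMax_nonneg (f : ℕ → ℝ) (K : ℕ) : 0 ≤ runMax f K := by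
  induction K with
  | zero => exact le_rfl
  | succ K ih => exact ih.trans (le_max_left _ _)

theorem one_le_degCap (n : ℕ) {ε T : ℝ} (hε : 0 < ε) (hT : 0 ≤ T) : 1 ≤ degCap n ε T := by
  have : 0 ≤ 8 * Real.log n / ε :=
    div_nonneg (mul_nonneg (by norm_num) (Real.log_natCast_nonneg n)) hε.le
  unfold degCap; linarith

theorem contrib_nonneg {T cap d : ℝ} (Dv Du : ℝ) (hd : 0 ≤ d) (hcap : 0 ≤ cap) :
    0 ≤ contrib T cap d Dv Du := by
  have : 0 ≤ min d cap := le_min hd hcap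
  unfold contrib
  split_ifs <;> linarith

theorem contrib_le {T cap d : ℝ} (Dv Du : ℝ) (hcap : 0 ≤ cap) :
    contrib T cap d Dv Du ≤ 2 * cap := by
  have : min d cap ≤ cap := min_le_right _ _
  unfold contrib
  split_ifs <;> linarith

/-- In stratified sampling no vertex is sampled often. -/
theorem card_sampleVertex_eq_le {n : ℕ} (hn : 0 < n) {k : ℕ} (hk : 0 < k) (ω : Coins) (v : ℕ) :
    (((Finset.range k).filter fun j => sampleVertex n k ω j = v).card : ℝ) ≤ k / n + 2 := by
  set F := (Finset.range k).filter fun j => sampleVertex n k ω j = v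
  have hn' : (0 : ℝ) < n := by exact_mod_cast hn
  have hk' : (0 : ℝ) < k := by exact_mod_cast hk
  -- The stratum of `j` must meet the unit interval starting at `v`. This confines `j` to a
  -- half-open interval of length k / n + 1, which contains at most k / n + 2 integers.
  have hF : ∀ j ∈ F, (v : ℝ) * (k / n) - 1 ≤ j ∧ (j : ℝ) < (v + 1) * (k / n) := by
    intro j hj
    have hj := (Finset.mem_filter.1 hj).2
    have h0 := (ω (4 * j + 2)).2.1
    have h1 := (ω (4 * j + 2)).2.2
    rw [sampleVertex, Nat.floor_eq_iff (by positivity)] at hj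
    have e : ((n : ℝ) / k) * (k / n) = 1 := by field_simp
    have hp : (0 : ℝ) < k / n := by positivity
    have a1 := mul_le_mul_of_nonneg_right hj.1 hp.le
    have a2 := mul_lt_mul_of_pos_right hj.2 hp
    rw [mul_assoc, e, mul_one] at a1 a2
    exact ⟨by linarith, by linarith⟩
  rcases F.eq_empty_or_nonempty with h | h
  · rw [h]; simp; positivity
  · have hsub : F ⊆ Finset.Icc (F.min' h) (F.max' h) := fun j hj =>
      Finset.mem_Icc.2 ⟨F.min'_le j hj, F.le_max' j hj⟩
    have hc := Finset.card_le_card hsub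
    rw [Nat.card_Icc] at hc
    have h1 := (hF _ (F.min'_mem h)).1
    have h2 := (hF _ (F.max'_mem h)).2
    have hle := F.min'_le _ (F.max'_mem h)
    have hc' : F.card + F.min' h ≤ F.max' h + 1 := by omega
    have hc'' : (F.card : ℝ) + F.min' h ≤ F.max' h + 1 := by exact_mod_cast hc'
    linarith

/-- Only samples at `a` or `b` differ, each by at most 2 · cap, and stratification bounds their
number. A sample whose neighbor is `a` or `b` does not change, because `D` is the same on both
sides. -/
theorem abs_sampleSum_sub_le {n : ℕ} (hn : 0 < n) {k : ℕ} (hk : 0 < k) {d d' : ℕ → ℝ}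
    {nb nb' : ℕ → ℕ → ℕ} {a b : ℕ} (hd : ∀ v, 0 ≤ d v) (hd' : ∀ v, 0 ≤ d' v)
    (h : ∀ v, v ≠ a → v ≠ b → d v = d' v) (hnb : ∀ v, v ≠ a → v ≠ b → nb v = nb' v)
    (T : ℝ) {cap : ℝ} (hcap : 0 ≤ cap) (D : ℕ → ℝ) (ω : Coins) :
    |sampleSum n k d (fun _ => nb) T cap D ω - sampleSum n k d' (fun _ => nb') T cap D ω| ≤
      4 * cap * (k / n + 2) := by
  rw [sampleSum, sampleSum, ← Finset.sum_sub_distrib]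
  have hterm (j : ℕ) : |sampleTerm n k d (fun _ => nb) T cap D ω j -
      sampleTerm n k d' (fun _ => nb') T cap D ω j| ≤
      (if sampleVertex n k ω j = a then 2 * cap else 0) +
        (if sampleVertex n k ω j = b then 2 * cap else 0) := by
    by_cases hab : sampleVertex n k ω j ≠ a ∧ sampleVertex n k ω j ≠ b
    · have e : sampleTerm n k d (fun _ => nb) T cap D ω j =
        sampleTerm n k d' (fun _ => nb') T cap D ω j := by
        simp [sampleTerm, sampleNbr, h _ hab.1 hab.2, hnb _ hab.1 hab.2]
      simp [e, hab.1, hab.2]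
    · have h1 : |sampleTerm n k d (fun _ => nb) T cap D ω j -
          sampleTerm n k d' (fun _ => nb') T cap D ω j| ≤ 2 * cap := by
        unfold sampleTerm
        rw [abs_le]
        constructor
        · linarith [contrib_nonneg (T := T) (D (sampleVertex n k ω j))
            (D (sampleNbr d (fun _ => nb) n k ω j)) (hd (sampleVertex n k ω j)) hcap,
            contrib_le (T := T) (d := d' (sampleVertex n k ω j)) (D (sampleVertex n k ω j))
            (D (sampleNbr d' (fun _ => nb') n k ω j)) hcap]
        · linarith [contrib_nonneg (T := T) (D (sampleVertex n k ω j))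
            (D (sampleNbr d' (fun _ => nb') n k ω j)) (hd' (sampleVertex n k ω j)) hcap,
            contrib_le (T := T) (d := d (sampleVertex n k ω j)) (D (sampleVertex n k ω j))
            (D (sampleNbr d (fun _ => nb) n k ω j)) hcap]
      refine h1.trans ?_
      by_cases ha : sampleVertex n k ω j = a
      · rw [if_pos ha]
        split_ifs <;> linarith
      · have hb : sampleVertex n k ω j = b := by
          by_contra hb; exact hab ⟨ha, hb⟩
        rw [if_neg ha, if_pos hb]; linarith
  refine (Finset.abs_sum_le_sum_abs _ _).trans ((Finset.sum_le_sum fun j _ => hterm j).trans ?_)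
  rw [Finset.sum_add_distrib, ← Finset.sum_filter, ← Finset.sum_filter, Finset.sum_const,
    Finset.sum_const, nsmul_eq_mul, nsmul_eq_mul]
  have ca := card_sampleVertex_eq_le hn hk ω a
  have cb := card_sampleVertex_eq_le hn hk ω b
  nlinarith

/-- Threshold and cap are computed from the noisy degrees alone, so both sides carry noise of the
same scale, and the sensitivity is ε/2 times that scale. -/
theorem coinLaw_estimateOf_le_of_degrees {n : ℕ} (hn : 0 < n) {ε : ℝ} (hε : 0 < ε) (ρ : ℝ)
    {d d' : ℕ → ℝ} (dg : ℕ → ℝ)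
    {nb nb' : ℕ → ℕ → ℕ} {a b : ℕ} (hd : ∀ v, 0 ≤ d v) (hd' : ∀ v, 0 ≤ d' v)
    (h : ∀ v, v ≠ a → v ≠ b → d v = d' v) (hnb : ∀ v, v ≠ a → v ≠ b → nb v = nb' v)
    {S : Set ℝ} (hS : MeasurableSet S) :
    coinLaw {ω | estimateOf n ε ρ d (fun _ => nb) (noisyDeg ε dg ω) ω ∈ S} ≤
      ENNReal.ofReal (Real.exp (ε / 2)) *
        coinLaw {ω | estimateOf n ε ρ d' (fun _ => nb') (noisyDeg ε dg ω) ω ∈ S} := by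
  refine coinLaw_le_mul_of_update 0
    (measurable_estimateOf n ε ρ d _ (measurable_noisyDeg ε dg) hS)
    (measurable_estimateOf n ε ρ d' _ (measurable_noisyDeg ε dg) hS) _ fun ω => ?_
  set k := sampleSize n ρ with hk
  have hk0 : 0 < k := Nat.succ_pos _
  set D := noisyDeg ε dg ω
  set T := threshold n ρ D ω
  set cap := degCap n ε T
  have hcap : 0 < cap := one_pos.trans_le (one_le_degCap n hε (runMax_nonneg _ _))
  have key (d₀ : ℕ → ℝ) (nb₀ : ℕ → ℕ → ℕ → ℕ) (x : unitInterval) :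
      estimateOf n ε ρ d₀ nb₀ (noisyDeg ε dg (Function.update ω 0 x)) (Function.update ω 0 x) =
        (sampleSum n k d₀ nb₀ T cap D ω + noiseScale n k ε cap * logit x) / k := by
    have hu (m : ℕ) (hm : m ≠ 0) : Function.update ω 0 x m = ω m :=
      Function.update_of_ne hm _ _
    rw [noisyDeg_update ε dg ω (by omega), estimateOf,
      threshold_congr n ρ _ fun j => hu _ (by omega),
      sampleSum_congr n _ d₀ nb₀ _ _ _ (fun j => hu _ (by omega)) (fun j => hu _ (by omega)),
      Function.update_self]
  simp only [Set.mem_preimage, key]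
  have hs : 0 < noiseScale n k ε cap := by unfold noiseScale; positivity
  refine volume_logit_le (fun y => y / k ∈ S) hs ?_
  refine (abs_sampleSum_sub_le hn hk0 hd hd' h hnb T hcap.le D ω).trans (le_of_eq ?_)
  unfold noiseScale
  field_simp
  ring

/-! ### Neighboring graphs -/

namespace AdjLists
variable {n : ℕ} {G : SimpleGraph (Fin n)} (L : AdjLists G)

theorem toFinset_nbrs [DecidableEq (Fin n)] [DecidableRel G.Adj] (v : Fin n) :
    (L.nbrs v).toFinset = G.neighborFinset v := by
  ext w; simp [L.mem_nbrs]

theorem length_nbrs [DecidableRel G.Adj] (v : Fin n) : (L.nbrs v).length = G.degree v := by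
  classical
  rw [← SimpleGraph.card_neighborFinset_eq_degree, ← L.toFinset_nbrs,
    List.toFinset_card_of_nodup (L.nodup v)]

theorem degQuery_of_lt [DecidableRel G.Adj] (v : Fin n) : L.degQuery v = G.degree v := by
  unfold degQuery
  rw [dif_pos v.2]
  convert rfl

theorem degQuery_nonneg (v : ℕ) : 0 ≤ L.degQuery v := by
  unfold degQuery
  split_ifs <;> positivity

theorem sum_nbrNat [DecidableRel G.Adj] (v : Fin n) (f : ℕ → ℝ) :
    ∑ i ∈ Finset.range (G.degree v), f (L.nbrNat v i) = ∑ w ∈ G.neighborFinset v, f w := by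
  classical
  rw [← L.toFinset_nbrs, List.sum_toFinset _ (L.nodup v), ← L.length_nbrs v, Finset.sum_range,
    ← List.sum_ofFn]
  congr 1
  apply List.ext_getElem
  · simp
  · intro i h1 h2
    simp at h2
    simp [nbrNat]

/-- The rounded index is uniform, so the probability is the proportion of neighbors satisfying `Q`,
whatever their order. Without neighbors, both oracles give 0. -/
theorem volume_nbrNat_eq (L' : AdjLists G) (v : ℕ) (Q : ℕ → Prop) :
    (volume : Measure unitInterval) {x | Q (L.nbrNat v ⌊(x : ℝ) * L.degQuery v⌋₊)} =
      (volume : Measure unitInterval) {x | Q (L'.nbrNat v ⌊(x : ℝ) * L.degQuery v⌋₊)} := by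
  classical
  by_cases hv : v < n
  · lift v to Fin n using hv
    rw [L.degQuery_of_lt v]
    rcases Nat.eq_zero_or_pos (G.degree v) with h0 | h0
    · have e (M : AdjLists G) : M.nbrs v = [] := by
        rw [← List.length_eq_zero_iff, M.length_nbrs, h0]
      simp [nbrNat, e]
    · rw [volume_floor_mul (fun i => Q (L.nbrNat v i)) h0,
        volume_floor_mul (fun i => Q (L'.nbrNat v i)) h0]
      have e (M : AdjLists G) :
          (((Finset.range (G.degree v)).filter fun i => Q (M.nbrNat v i)).card : ℝ) =
          ∑ w ∈ G.neighborFinset v, if Q w then 1 else 0 := by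
        rw [Finset.card_filter, ← M.sum_nbrNat v (fun w => if Q w then 1 else 0)]
        push_cast
        rfl
      rw [e, e]
  · simp [nbrNat, hv]

end AdjLists

theorem EdgeNeighboring.exists_endpoints {n : ℕ} {G₁ G₂ : SimpleGraph (Fin n)}
    (h : EdgeNeighboring G₁ G₂) : ∃ a b : Fin n, ∀ v w, G₁.Adj v w ≠ G₂.Adj v w →
      (v = a ∧ w = b) ∨ (v = b ∧ w = a) := by
  obtain ⟨e, he⟩ := h
  induction e with
  | h a b =>
  refine ⟨a, b, fun v w hvw => ?_⟩
  by_contra hc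
  apply hvw
  have hne : s(v, w) ≠ s(a, b) := by
    rw [Ne, Sym2.eq_iff]; exact hc
  have := Set.ext_iff.1 he s(v, w)
  simp only [Set.mem_sdiff, SimpleGraph.mem_edgeSet, Set.mem_singleton_iff, hne,
    not_false_eq_true, and_true] at this
  exact propext this

theorem degree_le_degree_add_one {n : ℕ} {G₁ G₂ : SimpleGraph (Fin n)} [DecidableRel G₁.Adj]
    [DecidableRel G₂.Adj] {v b : Fin n} (h : ∀ w, w ≠ b → G₁.Adj v w = G₂.Adj v w) :
    G₁.degree v ≤ G₂.degree v + 1 := by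
  classical
  rw [← SimpleGraph.card_neighborFinset_eq_degree, ← SimpleGraph.card_neighborFinset_eq_degree]
  refine (Finset.card_le_card (t := insert b (G₂.neighborFinset v)) fun w hw => ?_).trans
    (Finset.card_insert_le _ _)
  rw [Finset.mem_insert, SimpleGraph.mem_neighborFinset]
  by_cases hb : w = b
  · exact Or.inl hb
  · right; rw [← h w hb]; simpa using hw

theorem isEdgeDP_program (n : ℕ) {ε ρ : ℝ} (hε : 0 < ε) (hρ : 0 < ρ) :
    Estimator.program.IsEdgeDP n ε ρ := by
  classical
  intro G₁ G₂ hG L₁ L₂ S hS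
  obtain ⟨a, b, hab⟩ := hG.exists_endpoints
  have hn : 0 < n := a.pos
  have hadj (v : Fin n) (ha : v ≠ a) (hb : v ≠ b) (w : Fin n) : G₁.Adj v w = G₂.Adj v w := by
    by_contra hc
    rcases hab v w hc with h | h
    · exact ha h.1
    · exact hb h.1
  have hdeg (v : Fin n) : |L₁.degQuery v - L₂.degQuery v| ≤ 1 := by
    obtain ⟨c, hc⟩ : ∃ c, ∀ w, w ≠ c → G₁.Adj v w = G₂.Adj v w := by
      by_cases ha : v = a
      · refine ⟨b, fun w hw => ?_⟩
        by_contra hc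
        rcases hab v w hc with h | h
        · exact hw h.2
        · exact hw (by rw [h.2, ← ha, h.1])
      · refine ⟨a, fun w hw => ?_⟩
        by_contra hc
        rcases hab v w hc with h | h
        · exact ha h.1
        · exact hw h.2
    have h1 := degree_le_degree_add_one hc
    have h2 := degree_le_degree_add_one (G₁ := G₂) (G₂ := G₁) fun w hw => (hc w hw).symm
    rw [L₁.degQuery_of_lt, L₂.degQuery_of_lt, abs_le]
    have h1' : (G₁.degree v : ℝ) ≤ G₂.degree v + 1 := by exact_mod_cast h1
    have h2' : (G₂.degree v : ℝ) ≤ G₁.degree v + 1 := by exact_mod_cast h2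
    constructor <;> linarith
  -- Adjacency lists for `G₁` that agree literally with `L₂` away from the endpoints.
  let L : AdjLists G₁ :=
    { nbrs := fun v => if v = a ∨ v = b then L₁.nbrs v else L₂.nbrs v
      nodup := fun v => by split_ifs; exacts [L₁.nodup v, L₂.nodup v]
      mem_nbrs := fun v w => by
        split_ifs with h
        · exact L₁.mem_nbrs v w
        · rw [not_or] at h
          rw [L₂.mem_nbrs, hadj v h.1 h.2 w] }
  have hq : ∀ v : ℕ, v ≠ a → v ≠ b → L₁.degQuery v = L₂.degQuery v := by
    intro v ha hb
    by_cases hv : v < n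
    · lift v to Fin n using hv
      have ha' : v ≠ a := fun h => ha (by rw [h])
      have hb' : v ≠ b := fun h => hb (by rw [h])
      rw [L₁.degQuery_of_lt, L₂.degQuery_of_lt, ← SimpleGraph.card_neighborFinset_eq_degree,
        ← SimpleGraph.card_neighborFinset_eq_degree]
      congr 2
      ext w
      simp [hadj v ha' hb' w]
    · simp [AdjLists.degQuery, hv]
  have hnb : ∀ v : ℕ, v ≠ a → v ≠ b → L.nbrNat v = L₂.nbrNat v := by
    intro v ha hb
    funext i
    by_cases hv : v < n
    · have h : ¬ ((⟨v, hv⟩ : Fin n) = a ∨ (⟨v, hv⟩ : Fin n) = b) := by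
        rintro (h | h)
        · exact ha (by rw [← h])
        · exact hb (by rw [← h])
      simp [AdjLists.nbrNat, hv, L, h]
    · simp [AdjLists.nbrNat, hv]
  have hupd : Function.update (Function.update L₁.degQuery a (L₂.degQuery a)) b (L₂.degQuery b) =
      L₂.degQuery := by
    funext v
    by_cases hb : v = b
    · rw [hb, Function.update_self]
    · rw [Function.update_of_ne hb]
      by_cases ha : v = a
      · rw [ha, Function.update_self]
      · rw [Function.update_of_ne ha, hq v ha hb]
  -- The element `e` may be a diagonal pair; then `a = b` and the second update changes nothing.
  have hb1 : |Function.update L₁.degQuery a (L₂.degQuery a) b - L₂.degQuery b| ≤ 1 := by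
    by_cases h : (b : ℕ) = a
    · rw [h, Function.update_self]; simp
    · rw [Function.update_of_ne h]; exact hdeg b
  have s1 := coinLaw_estimateOf_eq n ε ρ L₁.degQuery L₁.degQuery L₁.nbrNat L.nbrNat
    (fun v Q => L₁.volume_nbrNat_eq L v Q) hS
  have s2 := coinLaw_estimateOf_le_of_noisyDeg n hε ρ L₁.degQuery L₁.degQuery (fun _ => L.nbrNat)
    a (hdeg a) hS
  have s3 := coinLaw_estimateOf_le_of_noisyDeg n hε ρ L₁.degQuery _ (fun _ => L.nbrNat) b hb1 hS
  rw [hupd] at s3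
  have s4 := coinLaw_estimateOf_le_of_degrees hn hε ρ L₂.degQuery L₁.degQuery_nonneg
    L₂.degQuery_nonneg hq hnb hS
  unfold Prog.prob
  simp only [Estimator.output_program _ _ hρ]
  have hexp : ENNReal.ofReal (Real.exp ε) = ENNReal.ofReal (Real.exp (ε / 4)) *
      (ENNReal.ofReal (Real.exp (ε / 4)) * ENNReal.ofReal (Real.exp (ε / 2))) := by
    rw [← ENNReal.ofReal_mul (Real.exp_pos _).le, ← ENNReal.ofReal_mul (Real.exp_pos _).le,
      ← Real.exp_add, ← Real.exp_add]
    congr 2; ring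
  rw [hexp, mul_assoc, mul_assoc]
  refine s1.trans (s2.trans (mul_le_mul_right ?_ _))
  exact s3.trans (mul_le_mul_right s4 _)

/-! ### The mean of the estimate -/

theorem sum_degQuery {n : ℕ} {G : SimpleGraph (Fin n)} (L : AdjLists G) :
    ∑ v ∈ Finset.range n, L.degQuery v = n * avgDegree G := by
  classical
  rcases Nat.eq_zero_or_pos n with h | h
  · subst h; simp
  · rw [Finset.sum_range, avgDegree, mul_div_cancel₀ _ (by positivity)]
    refine Finset.sum_congr rfl fun v _ => ?_
    rw [L.degQuery_of_lt]

/-- The number of vertices among `0, …, n - 1` at which `D` exceeds `T`. -/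
noncomputable def heavyCount (n : ℕ) (D : ℕ → ℝ) (T : ℝ) : ℕ :=
  ((Finset.range n).filter fun v => T < D v).card

/-- The expected contribution of vertex `v`, given that it is sampled. -/
noncomputable def meanContrib (d : ℕ → ℝ) (nb : ℕ → ℕ → ℕ) (T cap : ℝ) (D : ℕ → ℝ) (v : ℕ) : ℝ :=
  ∫ x : unitInterval, contrib T cap (d v) (D v) (D (nb v ⌊(x : ℝ) * d v⌋₊))

/-- For a light vertex the hypothesis makes the cap inactive, and the degree cancels the 1 / deg of
averaging over neighbors, leaving a sum over neighbors. -/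
theorem meanContrib_eq {n : ℕ} {G : SimpleGraph (Fin n)} [DecidableRel G.Adj] (L : AdjLists G)
    {T cap : ℝ} {D : ℕ → ℝ} (v : Fin n) (h : D v ≤ T → L.degQuery v ≤ cap) :
    meanContrib L.degQuery L.nbrNat T cap D v = ∑ w : Fin n, if G.Adj v w then
      (1 - if T < D v then 1 else 0) * (1 + if T < D w then 1 else 0) else 0 := by
  classical
  unfold meanContrib
  rw [← Finset.sum_filter, ← SimpleGraph.neighborFinset_eq_filter, L.degQuery_of_lt] at *
  by_cases hv : D v ≤ T
  · have hc (u : ℝ) : contrib T cap (G.degree v) (D v) u =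
        G.degree v * (1 + if T < u then 1 else 0) := by
      rw [contrib, if_pos hv, min_eq_left (h hv)]
      by_cases hu : u ≤ T
      · rw [if_pos hu, if_neg (not_lt.2 hu)]; ring
      · rw [if_neg hu, if_pos (not_le.1 hu)]; ring
    simp only [hc, not_lt.2 hv, if_false, sub_zero, one_mul]
    rcases Nat.eq_zero_or_pos (G.degree v) with h0 | h0
    · have : G.neighborFinset v = ∅ := by
        rw [← Finset.card_eq_zero, SimpleGraph.card_neighborFinset_eq_degree, h0]
      simp [h0, this]
    · rw [integral_floor_mul (fun i => (G.degree v : ℝ) *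
        (1 + if T < D (L.nbrNat v i) then 1 else 0)) h0, ← Finset.mul_sum,
        mul_div_cancel_left₀ _ (by positivity),
        L.sum_nbrNat v (fun w => 1 + if T < D w then 1 else 0)]
  · simp [contrib, hv, not_le.1 hv]

theorem sum_meanContrib {n : ℕ} {G : SimpleGraph (Fin n)} (L : AdjLists G)
    {T cap : ℝ} {D : ℕ → ℝ} (h : ∀ v < n, D v ≤ T → L.degQuery v ≤ cap) :
    n * avgDegree G - (heavyCount n D T : ℝ) ^ 2 ≤
        ∑ v ∈ Finset.range n, meanContrib L.degQuery L.nbrNat T cap D v ∧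
      ∑ v ∈ Finset.range n, meanContrib L.degQuery L.nbrNat T cap D v ≤ n * avgDegree G := by
  classical
  set H : Fin n → ℝ := fun v => if T < D v then 1 else 0 with hH
  have hH0 : ∀ v, 0 ≤ H v := fun v => by simp only [hH]; split_ifs <;> norm_num
  have hcount : (heavyCount n D T : ℝ) = ∑ v, H v := by
    rw [heavyCount, Finset.card_filter, Finset.sum_range]; push_cast; rfl
  have hdeg : n * avgDegree G = ∑ v : Fin n, ∑ w : Fin n, if G.Adj v w then (1 : ℝ) else 0 := by
    rw [← sum_degQuery L, Finset.sum_range]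
    refine Finset.sum_congr rfl fun v _ => ?_
    rw [L.degQuery_of_lt, Finset.sum_boole, ← SimpleGraph.neighborFinset_eq_filter,
      SimpleGraph.card_neighborFinset_eq_degree]
  -- Exchanging the two ends of an edge cancels what light vertices gain against what heavy vertices
  -- lose.
  have hsymm : ∑ v : Fin n, ∑ w : Fin n, (if G.Adj v w then H w else 0) =
      ∑ v : Fin n, ∑ w : Fin n, (if G.Adj v w then H v else 0) := by
    rw [Finset.sum_comm]
    simp only [G.adj_comm]
  have hmain : ∑ v ∈ Finset.range n, meanContrib L.degQuery L.nbrNat T cap D v =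
      n * avgDegree G - ∑ v : Fin n, ∑ w : Fin n, (if G.Adj v w then H v * H w else 0) := by
    rw [Finset.sum_range, Finset.sum_congr rfl fun v _ => meanContrib_eq L v (h v v.2)]
    have e (v w : Fin n) : (if G.Adj v w then (1 - H v) * (1 + H w) else 0) =
        (((if G.Adj v w then 1 else 0) + (if G.Adj v w then H w else 0)) -
          (if G.Adj v w then H v else 0)) - (if G.Adj v w then H v * H w else 0) := by
      split_ifs <;> ring
    change ∑ v : Fin n, ∑ w : Fin n, (if G.Adj v w then (1 - H v) * (1 + H w) else 0) = _
    simp only [e, Finset.sum_sub_distrib, Finset.sum_add_distrib, hsymm, hdeg]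
    ring
  have hnonneg : 0 ≤ ∑ v : Fin n, ∑ w : Fin n, (if G.Adj v w then H v * H w else 0) :=
    Finset.sum_nonneg fun v _ => Finset.sum_nonneg fun w _ => by
      split_ifs
      · exact mul_nonneg (hH0 v) (hH0 w)
      · exact le_rfl
  have hle : ∑ v : Fin n, ∑ w : Fin n, (if G.Adj v w then H v * H w else 0) ≤
      (heavyCount n D T : ℝ) ^ 2 := by
    rw [hcount, sq, Finset.sum_mul_sum]
    refine Finset.sum_le_sum fun v _ => Finset.sum_le_sum fun w _ => ?_
    split_ifs
    · exact le_rfl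
    · exact mul_nonneg (hH0 v) (hH0 w)
  rw [hmain]
  constructor <;> linarith

/-! ### Concentration of the sum of the samples -/

section Concentration

variable {n k : ℕ} {d : ℕ → ℝ} {nb : ℕ → ℕ → ℕ} {T cap : ℝ} {D : ℕ → ℝ}

theorem measurable_sampleTerm_const (n k : ℕ) (d : ℕ → ℝ) (nb : ℕ → ℕ → ℕ → ℕ) (T cap : ℝ)
    (D : ℕ → ℝ) (j : ℕ) : Measurable fun ω => sampleTerm n k d nb T cap D ω j :=
  measurable_sampleTerm n k d nb (T := fun _ => T) (cap := fun _ => cap) (D := fun _ => D)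
    measurable_const measurable_const (fun _ => measurable_const) j

theorem sampleTerm_nonneg (hd : ∀ v, 0 ≤ d v) (hcap : 0 ≤ cap) (ω : Coins) (j : ℕ) :
    0 ≤ sampleTerm n k d (fun _ => nb) T cap D ω j :=
  contrib_nonneg _ _ (hd _) hcap

theorem sampleTerm_le (hcap : 0 ≤ cap) (ω : Coins) (j : ℕ) :
    sampleTerm n k d (fun _ => nb) T cap D ω j ≤ 2 * cap :=
  contrib_le _ _ hcap

theorem memLp_sampleTerm (hd : ∀ v, 0 ≤ d v) (hcap : 0 ≤ cap) (j : ℕ) (p : ℝ≥0∞) :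
    MemLp (fun ω => sampleTerm n k d (fun _ => nb) T cap D ω j) p coinLaw :=
  MemLp.of_bound (measurable_sampleTerm_const n k d _ T cap D j).aestronglyMeasurable (2 * cap)
    (.of_forall fun ω => by
      rw [Real.norm_eq_abs, abs_of_nonneg (sampleTerm_nonneg hd hcap ω j)]
      exact sampleTerm_le hcap ω j)

theorem integral_sampleTerm (hd : ∀ v, 0 ≤ d v) (hcap : 0 ≤ cap) (j : ℕ) :
    ∫ ω, sampleTerm n k d (fun _ => nb) T cap D ω j ∂coinLaw =
      ∫ x : unitInterval, meanContrib d nb T cap D ⌊((j : ℝ) + x) * ((n : ℝ) / k)⌋₊ := by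
  rw [integral_coinLaw_update (4 * j + 3) (measurable_sampleTerm_const n k d _ T cap D j)
    (memLp_one_iff_integrable.1 (memLp_sampleTerm hd hcap j 1))]
  have e (ω : Coins) : ∫ x : unitInterval,
      sampleTerm n k d (fun _ => nb) T cap D (Function.update ω (4 * j + 3) x) j =
      meanContrib d nb T cap D ⌊((j : ℝ) + ω (4 * j + 2)) * ((n : ℝ) / k)⌋₊ := by
    unfold meanContrib
    congr 1
    funext x
    simp [sampleTerm, sampleNbr, sampleVertex]
  simp only [e]
  have hg : Measurable (meanContrib d nb T cap D) := .of_discrete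
  have hf : Measurable fun x : unitInterval => ⌊((j : ℝ) + x) * ((n : ℝ) / k)⌋₊ := by fun_prop
  have hm := hg.comp hf
  have := measurePreserving_coin (4 * j + 2)
  rw [← this.map_eq]
  exact (integral_map (φ := fun ω : Coins => ω (4 * j + 2)) this.aemeasurable
    (hm.aestronglyMeasurable)).symm

theorem sum_integral_sampleTerm (hn : 0 < n) (hk : 0 < k) (hd : ∀ v, 0 ≤ d v) (hcap : 0 ≤ cap) :
    ∑ j ∈ Finset.range k, ∫ ω, sampleTerm n k d (fun _ => nb) T cap D ω j ∂coinLaw =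
      k / n * ∑ v ∈ Finset.range n, meanContrib d nb T cap D v := by
  simp only [integral_sampleTerm hd hcap]
  exact sum_integral_stratified _ hn hk

/-- With threshold, cap and noisy degrees constant, sample `j` reads only the coins 4j + 2 and 4j +
3. -/
theorem indepFun_sampleTerm (n k : ℕ) (d : ℕ → ℝ) (nb : ℕ → ℕ → ℕ → ℕ) (T cap : ℝ)
    (D : ℕ → ℝ) {i j : ℕ} (hij : i ≠ j) :
    ProbabilityTheory.IndepFun (fun ω => sampleTerm n k d nb T cap D ω i)
      (fun ω => sampleTerm n k d nb T cap D ω j) coinLaw := by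
  classical
  have hind : ProbabilityTheory.iIndepFun (fun (i : ℕ) (ω : Coins) => ω i) coinLaw :=
    ProbabilityTheory.iIndepFun_infinitePi (P := fun _ : ℕ => (volume : Measure unitInterval))
      (X := fun _ x => x) (fun _ => measurable_id)
  let s (i : ℕ) : Finset ℕ := {4 * i + 2, 4 * i + 3}
  have hdis : Disjoint (s i) (s j) := by
    simp only [s, Finset.disjoint_left, Finset.mem_insert, Finset.mem_singleton]
    omega
  have h := hind.indepFun_finset (s i) (s j) hdis (fun _ => by fun_prop)
  let ext (i : ℕ) (y : s i → unitInterval) : Coins := fun m => if hm : m ∈ s i then y ⟨m, hm⟩ else 0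
  have hext (i : ℕ) : Measurable (ext i) := by
    refine measurable_pi_lambda _ fun m => ?_
    by_cases hm : m ∈ s i
    · simp only [ext, hm, dif_pos]; fun_prop
    · simp only [ext, hm]; exact measurable_const
  have e (i : ℕ) : (fun ω => sampleTerm n k d nb T cap D ω i) =
      (fun y => sampleTerm n k d nb T cap D (ext i y) i) ∘ fun (ω : Coins) (m : s i) => ω m := by
    funext ω
    simp [sampleTerm, sampleNbr, sampleVertex, ext, s]
  rw [e i, e j]
  exact h.comp ((measurable_sampleTerm_const n k d nb T cap D i).comp (hext i))
    ((measurable_sampleTerm_const n k d nb T cap D j).comp (hext j))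

/-- Chebyshev: the terms lie between 0 and 2 · cap, so the variance of each is at most 2 · cap times
its mean, and pairwise independence adds the variances. -/
theorem coinLaw_deviation_le (hn : 0 < n) (hk : 0 < k) (hd : ∀ v, 0 ≤ d v) (hcap : 0 ≤ cap)
    {c : ℝ} (hc : 0 < c) :
    coinLaw {ω | c ≤ |sampleSum n k d (fun _ => nb) T cap D ω -
        k / n * ∑ v ∈ Finset.range n, meanContrib d nb T cap D v|} ≤
      ENNReal.ofReal (2 * cap * (k / n * ∑ v ∈ Finset.range n, meanContrib d nb T cap D v)
        / c ^ 2) := by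
  rw [← sum_integral_sampleTerm hn hk hd hcap]
  let X (j : ℕ) (ω : Coins) := sampleTerm n k d (fun _ => nb) T cap D ω j
  have hX (j : ℕ) (p : ℝ≥0∞) : MemLp (X j) p coinLaw := memLp_sampleTerm hd hcap j p
  have hXi (j : ℕ) : Integrable (X j) coinLaw := memLp_one_iff_integrable.1 (hX j 1)
  have hsum : (fun ω => sampleSum n k d (fun _ => nb) T cap D ω) = ∑ j ∈ Finset.range k, X j := by
    funext ω; simp [sampleSum, X]
  have hmean : ∫ ω, (∑ j ∈ Finset.range k, X j) ω ∂coinLaw =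
      ∑ j ∈ Finset.range k, ∫ ω, X j ω ∂coinLaw := by
    simp only [Finset.sum_apply]
    exact integral_finsetSum _ fun j _ => hXi j
  have h := ProbabilityTheory.meas_ge_le_variance_div_sq
    (memLp_finsetSum' (Finset.range k) fun j _ => hX j 2) hc
  rw [hmean] at h
  have hvar : ProbabilityTheory.variance (∑ j ∈ Finset.range k, X j) coinLaw ≤
      2 * cap * ∑ j ∈ Finset.range k, ∫ ω, X j ω ∂coinLaw := by
    rw [ProbabilityTheory.IndepFun.variance_sum (fun j _ => hX j 2)
      (fun i _ j _ hij => indepFun_sampleTerm n k d _ T cap D hij), Finset.mul_sum]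
    refine Finset.sum_le_sum fun j _ => ?_
    refine (ProbabilityTheory.variance_le_expectation_sq (hX j 2).aestronglyMeasurable).trans ?_
    rw [← integral_const_mul]
    refine integral_mono (hX j 2).integrable_sq ((hXi j).const_mul _) fun ω => ?_
    have h0 : 0 ≤ X j ω := sampleTerm_nonneg hd hcap ω j
    have h1 : X j ω ≤ 2 * cap := sampleTerm_le hcap ω j
    simp only [Pi.pow_apply]
    nlinarith
  refine le_trans (le_of_eq ?_) (h.trans (ENNReal.ofReal_le_ofReal (by gcongr)))
  congr 1
  ext ω
  simp only [Set.mem_ofPred_eq, ← hsum, X]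

end Concentration

/-! ### The degree threshold -/

theorem le_runMax (f : ℕ → ℝ) {j K : ℕ} (hj : j < K) : f j ≤ runMax f K := by
  induction K with
  | zero => omega
  | succ K ih =>
    rcases Nat.lt_succ_iff_lt_or_eq.1 hj with h | h
    · exact (ih h).trans (le_max_left _ _)
    · rw [h]; exact le_max_right _ _

theorem runMax_le (f : ℕ → ℝ) {K : ℕ} {M : ℝ} (h0 : 0 ≤ M) (h : ∀ j < K, f j ≤ M) :
    runMax f K ≤ M := by
  induction K with
  | zero => exact h0
  | succ K ih => exact max_le (ih fun j hj => h j (by omega)) (h K (by omega))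

theorem preVertex_le (n : ℕ) (ω : Coins) (j : ℕ) : preVertex n ω j ≤ n := by
  rw [preVertex]
  refine Nat.floor_le_of_le ?_
  have := (ω (4 * j + 1)).2.2
  exact mul_le_of_le_one_right (by positivity) this

theorem coinLaw_preVertex (n : ℕ) (hn : 0 < n) (j : ℕ) (Q : ℕ → Prop) [DecidablePred Q] :
    coinLaw {ω | Q (preVertex n ω j)} =
      ENNReal.ofReal (((Finset.range n).filter Q).card / n) := by
  rw [← volume_floor_mul Q hn]
  have hm : MeasurableSet {x : unitInterval | Q ⌊(x : ℝ) * n⌋₊} :=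
    (Nat.measurable_floor.comp (measurable_subtype_coe.mul_const _))
      (MeasurableSet.of_discrete (s := {i | Q i}))
  rw [← (measurePreserving_coin (4 * j + 1)).measure_preimage hm.nullMeasurableSet]
  simp [preVertex, mul_comm]

/-- A level at which fewer than `h` values exceed it, but at least `h` values reach it. -/
theorem exists_level {n : ℕ} (D : ℕ → ℝ) {h : ℝ} (h0 : 0 < h) (hn : h ≤ n) :
    ∃ τ, (heavyCount n D τ : ℝ) < h ∧
      h ≤ ((Finset.range n).filter fun v => τ ≤ D v).card := by
  classical
  have hn0 : 0 < n := by
    rcases Nat.eq_zero_or_pos n with h1 | h1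
    · subst h1; simp at hn; linarith
    · exact h1
  let c (v : ℕ) : Finset ℕ := (Finset.range n).filter fun w => D v ≤ D w
  -- The level is the largest value of `D` that at least `h` vertices reach. Were it exceeded by `h`
  -- vertices, the smallest value above it would also qualify.
  let F := (Finset.range n).filter fun v => h ≤ (c v).card
  have hF : F.Nonempty := by
    obtain ⟨v, hv, hmin⟩ := Finset.exists_min_image (Finset.range n) D ⟨0, by simpa using hn0⟩
    refine ⟨v, Finset.mem_filter.2 ⟨hv, ?_⟩⟩
    have : c v = Finset.range n := Finset.filter_true_of_mem hmin
    rw [this]; simpa using hn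
  obtain ⟨v, hv, hmax⟩ := Finset.exists_max_image F D hF
  refine ⟨D v, ?_, (Finset.mem_filter.1 hv).2⟩
  by_contra hc
  rw [not_lt] at hc
  let H := (Finset.range n).filter fun w => D v < D w
  have hH : H.Nonempty := by
    rw [← Finset.card_pos]
    have : (0 : ℝ) < heavyCount n D (D v) := h0.trans_le hc
    exact_mod_cast this
  obtain ⟨u, hu, hmin⟩ := Finset.exists_min_image H D hH
  have hu' := Finset.mem_filter.1 hu
  have hsub : H ⊆ c u := fun w hw =>
    Finset.mem_filter.2 ⟨(Finset.mem_filter.1 hw).1, hmin w hw⟩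
  have : u ∈ F := Finset.mem_filter.2 ⟨hu'.1, hc.trans (by exact_mod_cast Finset.card_le_card hsub)⟩
  exact absurd (hmax u this) (not_le.2 hu'.2)

/-- The draws are independent and each misses `W` with probability 1 - |W| / n, which is at most
exp(-|W| / n). -/
theorem coinLaw_forall_preVertex_le {n : ℕ} (hn : 0 < n) (W : Finset ℕ) (hW : W ⊆ Finset.range n)
    (K : ℕ) : coinLaw {ω | ∀ j < K, preVertex n ω j ∉ W} ≤
      ENNReal.ofReal (Real.exp (-(W.card * K / n))) := by
  classical
  let t : Set unitInterval := {x | ⌊(x : ℝ) * n⌋₊ ∉ W}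
  have ht : MeasurableSet t :=
    (Nat.measurable_floor.comp (measurable_subtype_coe.mul_const _))
      (MeasurableSet.of_discrete (s := {i | i ∉ W}))
  let s : Finset ℕ := (Finset.range K).image fun j => 4 * j + 1
  have e : {ω : Coins | ∀ j < K, preVertex n ω j ∉ W} = (s : Set ℕ).pi fun _ => t := by
    ext ω
    simp [s, t, preVertex, mul_comm, Set.mem_pi]
  have hs : s.card = K := by
    rw [Finset.card_image_of_injective _ (fun a b h => by simpa using h), Finset.card_range]
  have hvol : volume t = ENNReal.ofReal (1 - W.card / n) := by
    rw [volume_floor_mul (fun i => i ∉ W) hn]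
    congr 1
    have h1 : (Finset.range n).filter (fun i => i ∉ W) = Finset.range n \ W := by
      ext; simp
    rw [h1, Finset.card_sdiff_of_subset hW, Nat.cast_sub (Finset.card_le_card hW),
      Finset.card_range]
    have : (n : ℝ) ≠ 0 := by positivity
    field_simp
  have hle : (W.card : ℝ) / n ≤ 1 := by
    rw [div_le_one (by positivity)]
    exact_mod_cast (Finset.card_le_card hW).trans (by simp)
  rw [e, coinLaw, Measure.infinitePi_pi _ fun _ _ => ht, Finset.prod_const, hs, hvol,
    ← ENNReal.ofReal_pow (by linarith)]
  refine ENNReal.ofReal_le_ofReal ?_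
  calc (1 - (W.card : ℝ) / n) ^ K ≤ Real.exp (-(W.card / n)) ^ K :=
        pow_le_pow_left₀ (by linarith) (by linarith [Real.add_one_le_exp (-((W.card : ℝ) / n))]) _
    _ = Real.exp (-(W.card * K / n)) := by rw [← Real.exp_nat_mul]; congr 1; ring

theorem heavyCount_anti {n : ℕ} {D : ℕ → ℝ} {T T' : ℝ} (h : T ≤ T') :
    heavyCount n D T' ≤ heavyCount n D T :=
  Finset.card_le_card fun v hv => by
    rw [Finset.mem_filter] at hv ⊢
    exact ⟨hv.1, h.trans_lt hv.2⟩

/-- If a draw hits the set of at least `h` vertices reaching the level of `exists_level`, the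
threshold is at least that level, and fewer than `h` vertices exceed it. -/
theorem coinLaw_heavyCount_le_of_const {n : ℕ} (hn : 0 < n) (ρ : ℝ) (D : ℕ → ℝ) {h : ℝ}
    (h0 : 0 < h) :
    coinLaw {ω | h ≤ heavyCount n D (threshold n ρ D ω)} ≤
      ENNReal.ofReal (Real.exp (-(h * preSize n ρ / n))) := by
  by_cases hhn : h ≤ n
  · obtain ⟨τ, h1, h2⟩ := exists_level D h0 hhn
    set W := (Finset.range n).filter fun v => τ ≤ D v
    refine (measure_mono (t := {ω | ∀ j < preSize n ρ, preVertex n ω j ∉ W}) ?_).trans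
      ((coinLaw_forall_preVertex_le hn W (Finset.filter_subset _ _) _).trans ?_)
    · intro ω hω j hj hW
      have h3 : τ ≤ threshold n ρ D ω :=
        (Finset.mem_filter.1 hW).2.trans (le_runMax (fun j => D (preVertex n ω j)) hj)
      have h4 : (heavyCount n D (threshold n ρ D ω) : ℝ) ≤ heavyCount n D τ := by
        exact_mod_cast heavyCount_anti h3
      have h5 : h ≤ heavyCount n D (threshold n ρ D ω) := hω
      linarith
    · refine ENNReal.ofReal_le_ofReal (Real.exp_le_exp.2 (neg_le_neg ?_))
      gcongr
  -- Beyond `n` the event is impossible.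
  · have : {ω | h ≤ heavyCount n D (threshold n ρ D ω)} = ∅ := by
      ext ω
      simp only [Set.mem_ofPred_eq, Set.mem_empty_iff_false, iff_false, not_le]
      refine lt_of_le_of_lt ?_ (not_le.1 hhn)
      have : heavyCount n D (threshold n ρ D ω) ≤ n :=
        (Finset.card_filter_le _ _).trans (by simp)
      exact_mod_cast this
    rw [this]; simp

theorem noisyDeg_congr (ε : ℝ) (dg : ℕ → ℝ) {ω ω' : Coins}
    (h : ∀ v, ω' (4 * v + 4) = ω (4 * v + 4)) : noisyDeg ε dg ω' = noisyDeg ε dg ω := by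
  funext v; simp [noisyDeg, h]

theorem measurable_heavyCount (n : ℕ) {D : Coins → ℕ → ℝ} {T : Coins → ℝ}
    (hD : ∀ v, Measurable fun ω => D ω v) (hT : Measurable T) :
    Measurable fun ω => (heavyCount n (D ω) (T ω) : ℝ) := by
  have : (fun ω => (heavyCount n (D ω) (T ω) : ℝ)) =
      fun ω => ∑ v ∈ Finset.range n, if T ω < D ω v then (1 : ℝ) else 0 := by
    funext ω; rw [heavyCount, Finset.card_filter]; push_cast; rfl
  rw [this]
  exact Finset.measurable_sum _ fun v _ =>
    Measurable.ite (measurableSet_lt hT (hD v)) measurable_const measurable_const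

theorem coinLaw_heavyCount_le {n : ℕ} (hn : 0 < n) (ε ρ : ℝ) (dg : ℕ → ℝ) {h : ℝ} (h0 : 0 < h) :
    coinLaw {ω | h ≤ heavyCount n (noisyDeg ε dg ω) (threshold n ρ (noisyDeg ε dg ω) ω)} ≤
      ENNReal.ofReal (Real.exp (-(h * preSize n ρ / n))) := by
  have hD := measurable_noisyDeg ε dg
  refine coinLaw_le_of_mix {i | i % 4 = 1} (measurableSet_le measurable_const
    (measurable_heavyCount n hD (measurable_threshold n ρ hD))) _ fun ω => ?_
  have e (ω' : Coins) : noisyDeg ε dg (mix {i | i % 4 = 1} ω ω') = noisyDeg ε dg ω :=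
    noisyDeg_congr ε dg fun v => mix_of_notMem (by simp only [Set.mem_ofPred_eq]; omega) _ _
  have e' (D : ℕ → ℝ) (ω' : Coins) :
      threshold n ρ D (mix {i | i % 4 = 1} ω ω') = threshold n ρ D ω' :=
    threshold_congr n ρ D fun v => mix_of_mem (by simp only [Set.mem_ofPred_eq]; omega) _ _
  simp only [Set.mem_ofPred_eq, e, e']
  exact coinLaw_heavyCount_le_of_const hn ρ _ h0

/-- Markov's inequality for the degree of a uniform vertex, and a union bound over the draws. -/
theorem coinLaw_exists_lt_preVertex_le {n : ℕ} (hn : 0 < n) {G : SimpleGraph (Fin n)}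
    (L : AdjLists G) {B : ℝ} (hB : 0 < B) (K : ℕ) :
    coinLaw {ω | ∃ j < K, B < L.degQuery (preVertex n ω j)} ≤
      ENNReal.ofReal (K * avgDegree G / B) := by
  classical
  have e : {ω | ∃ j < K, B < L.degQuery (preVertex n ω j)} =
      ⋃ j ∈ Finset.range K, {ω | B < L.degQuery (preVertex n ω j)} := by
    ext ω; simp
  have hmarkov : (((Finset.range n).filter fun v => B < L.degQuery v).card : ℝ) / n ≤
      avgDegree G / B := by
    have h1 : B * ((Finset.range n).filter fun v => B < L.degQuery v).card ≤ n * avgDegree G := by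
      rw [← sum_degQuery L, mul_comm, ← nsmul_eq_mul]
      refine (Finset.card_nsmul_le_sum _ _ _ fun v hv => (Finset.mem_filter.1 hv).2.le).trans ?_
      exact Finset.sum_le_sum_of_subset_of_nonneg (Finset.filter_subset _ _)
        fun v _ _ => L.degQuery_nonneg v
    rw [div_le_div_iff₀ (by positivity) hB]
    linarith
  rw [e]
  refine (measure_biUnion_finset_le _ _).trans ?_
  simp only [coinLaw_preVertex n hn _ fun v => B < L.degQuery v, Finset.sum_const,
    Finset.card_range, nsmul_eq_mul]
  rw [← ENNReal.ofReal_natCast, ← ENNReal.ofReal_mul (by positivity), mul_div_assoc]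
  exact ENNReal.ofReal_le_ofReal (by gcongr)

theorem coinLaw_lt_abs_logit_le (i : ℕ) (t : ℝ) :
    coinLaw {ω | t < |logit (ω i)|} ≤ ENNReal.ofReal (2 * Real.exp (-t)) := by
  have hm : MeasurableSet {x : unitInterval | t < |logit x|} :=
    measurableSet_lt measurable_const (measurable_logit.comp measurable_subtype_coe).abs
  refine le_trans (le_of_eq ?_) (volume_lt_abs_logit_le t)
  exact (measurePreserving_coin i).measure_preimage hm.nullMeasurableSet

/-- A union bound with failure probability 2 / n² per index. The index `n` is included because
`preVertex` can take that value. -/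
theorem coinLaw_exists_lt_abs_logit_le {n : ℕ} (hn : 0 < n) :
    coinLaw {ω | ∃ v ≤ n, 2 * Real.log n < |logit (ω (4 * v + 4))|} ≤
      ENNReal.ofReal (4 / n) := by
  have e : {ω : Coins | ∃ v ≤ n, 2 * Real.log n < |logit (ω (4 * v + 4))|} =
      ⋃ v ∈ Finset.range (n + 1), {ω | 2 * Real.log n < |logit (ω (4 * v + 4))|} := by
    ext ω; simp
  have hn' : (1 : ℝ) ≤ n := by exact_mod_cast hn
  have hexp : Real.exp (-(2 * Real.log n)) = 1 / (n : ℝ) ^ 2 := by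
    rw [Real.exp_neg, two_mul, Real.exp_add, Real.exp_log (by positivity)]
    field_simp
  rw [e]
  refine (measure_biUnion_finset_le _ _).trans ((Finset.sum_le_sum fun v _ =>
    coinLaw_lt_abs_logit_le _ _).trans ?_)
  rw [Finset.sum_const, Finset.card_range, nsmul_eq_mul, ← ENNReal.ofReal_natCast,
    ← ENNReal.ofReal_mul (by positivity), hexp]
  refine ENNReal.ofReal_le_ofReal ?_
  push_cast
  rw [← sub_nonneg]
  have : 4 / (n : ℝ) - (n + 1) * (2 * (1 / (n : ℝ) ^ 2)) = 2 * (n - 1) / (n : ℝ) ^ 2 := by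
    field_simp; ring
  rw [this]
  exact div_nonneg (by linarith) (by positivity)

/-! ### Accuracy for fixed parameters -/

section Accuracy

variable {n : ℕ} {G : SimpleGraph (Fin n)} (L : AdjLists G) (ε ρ : ℝ)

/-- The conditions on the noisy degrees and on the threshold under which the sum of the sampled
contributions concentrates. -/
def GoodThreshold (C h : ℝ) (ω : Coins) : Prop :=
  (∀ v < n, noisyDeg ε L.degQuery ω v ≤ threshold n ρ (noisyDeg ε L.degQuery ω) ω →
    L.degQuery v ≤ degCap n ε (threshold n ρ (noisyDeg ε L.degQuery ω) ω)) ∧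
  degCap n ε (threshold n ρ (noisyDeg ε L.degQuery ω) ω) ≤ C ∧
  (heavyCount n (noisyDeg ε L.degQuery ω) (threshold n ρ (noisyDeg ε L.degQuery ω) ω) : ℝ) < h

/-- The sum from which the estimate is obtained by adding noise. -/
noncomputable def privateSum (ω : Coins) : ℝ :=
  sampleSum n (sampleSize n ρ) L.degQuery (fun _ => L.nbrNat)
    (threshold n ρ (noisyDeg ε L.degQuery ω) ω)
    (degCap n ε (threshold n ρ (noisyDeg ε L.degQuery ω) ω)) (noisyDeg ε L.degQuery ω) ω

theorem measurableSet_goodThreshold (C h : ℝ) :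
    MeasurableSet {ω | GoodThreshold L ε ρ C h ω} := by
  have hD := measurable_noisyDeg ε L.degQuery
  have hT := measurable_threshold n ρ hD
  have hcap : Measurable fun ω => degCap n ε (threshold n ρ (noisyDeg ε L.degQuery ω) ω) := by
    unfold degCap; fun_prop
  have e : {ω | GoodThreshold L ε ρ C h ω} = (⋂ v, {ω | v < n → noisyDeg ε L.degQuery ω v ≤
      threshold n ρ (noisyDeg ε L.degQuery ω) ω →
      L.degQuery v ≤ degCap n ε (threshold n ρ (noisyDeg ε L.degQuery ω) ω)}) ∩
      ({ω | degCap n ε (threshold n ρ (noisyDeg ε L.degQuery ω) ω) ≤ C} ∩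
      {ω | (heavyCount n (noisyDeg ε L.degQuery ω)
        (threshold n ρ (noisyDeg ε L.degQuery ω) ω) : ℝ) < h}) := by
    ext ω; simp [GoodThreshold]
  rw [e]
  refine MeasurableSet.inter (MeasurableSet.iInter fun v => ?_)
    ((measurableSet_le hcap measurable_const).inter
    (measurableSet_lt (measurable_heavyCount n hD hT) measurable_const))
  exact (MeasurableSet.const _).imp ((measurableSet_le (hD v) hT).imp
    (measurableSet_le measurable_const hcap))

theorem measurable_privateSum : Measurable (privateSum L ε ρ) := by
  have hD := measurable_noisyDeg ε L.degQuery
  have hT := measurable_threshold n ρ hD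
  have hcap : Measurable fun ω => degCap n ε (threshold n ρ (noisyDeg ε L.degQuery ω) ω) := by
    unfold degCap; fun_prop
  exact measurable_sampleSum n _ _ _ hT hcap hD

/-- The coins that determine noisy degrees and threshold are frozen; the sampling coins, of residue
2 and 3 modulo 4, remain fresh. Under `GoodThreshold` the conditional mean falls short of its target
by at most k h² / n, and Chebyshev handles the fluctuation `c`. -/
theorem coinLaw_privateSum_deviation_le (hn : 0 < n) (hε : 0 < ε) {C h c : ℝ} (hc : 0 < c) :
    coinLaw {ω | GoodThreshold L ε ρ C h ω ∧ c + sampleSize n ρ * h ^ 2 / n <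
        |privateSum L ε ρ ω - sampleSize n ρ * avgDegree G|} ≤
      ENNReal.ofReal (2 * C * (sampleSize n ρ * avgDegree G) / c ^ 2) := by
  set k := sampleSize n ρ with hkdef
  have hk : 0 < k := Nat.succ_pos _
  have hn' : (0 : ℝ) < n := by exact_mod_cast hn
  have hk' : (0 : ℝ) < k := by exact_mod_cast hk
  let I : Set ℕ := {i | i % 4 = 2 ∨ i % 4 = 3}
  refine coinLaw_le_of_mix I ((measurableSet_goodThreshold L ε ρ C h).inter
    (measurableSet_lt measurable_const ((measurable_privateSum L ε ρ).sub_const _).abs)) _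
    fun ω => ?_
  have eD (ω' : Coins) : noisyDeg ε L.degQuery (mix I ω ω') = noisyDeg ε L.degQuery ω :=
    noisyDeg_congr ε _ fun v => mix_of_notMem (by simp only [I, Set.mem_ofPred_eq]; omega) _ _
  have eT (D : ℕ → ℝ) (ω' : Coins) : threshold n ρ D (mix I ω ω') = threshold n ρ D ω :=
    threshold_congr n ρ D fun v => mix_of_notMem (by simp only [I, Set.mem_ofPred_eq]; omega) _ _
  have eS (T cap : ℝ) (D : ℕ → ℝ) (ω' : Coins) :
      sampleSum n k L.degQuery (fun _ => L.nbrNat) T cap D (mix I ω ω') =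
        sampleSum n k L.degQuery (fun _ => L.nbrNat) T cap D ω' :=
    sampleSum_congr n k _ _ T cap D
      (fun v => mix_of_mem (by simp only [I, Set.mem_ofPred_eq]; omega) _ _)
      (fun v => mix_of_mem (by simp only [I, Set.mem_ofPred_eq]; omega) _ _)
  have eG (ω' : Coins) : GoodThreshold L ε ρ C h (mix I ω ω') ↔ GoodThreshold L ε ρ C h ω := by
    simp only [GoodThreshold, eD, eT]
  have eP (ω' : Coins) : privateSum L ε ρ (mix I ω ω') =
      sampleSum n k L.degQuery (fun _ => L.nbrNat)
        (threshold n ρ (noisyDeg ε L.degQuery ω) ω)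
        (degCap n ε (threshold n ρ (noisyDeg ε L.degQuery ω) ω)) (noisyDeg ε L.degQuery ω) ω' := by
    simp only [privateSum, eD, eT, ← hkdef, eS]
  by_cases hgood : GoodThreshold L ε ρ C h ω
  · obtain ⟨g1, g2, g3⟩ := id hgood
    set D := noisyDeg ε L.degQuery ω
    set T := threshold n ρ D ω
    set cap := degCap n ε T
    have hcap : 0 ≤ cap := zero_le_one.trans (one_le_degCap n hε (runMax_nonneg _ _))
    obtain ⟨m1, m2⟩ := sum_meanContrib L g1
    set M := ∑ v ∈ Finset.range n, meanContrib L.degQuery L.nbrNat T cap D v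
    have hM0 : (k : ℝ) / n * M ≤ k * avgDegree G := by
      calc (k : ℝ) / n * M ≤ k / n * (n * avgDegree G) := by gcongr
        _ = k * avgDegree G := by field_simp
    have hM1 : k * avgDegree G - k * h ^ 2 / n ≤ (k : ℝ) / n * M := by
      have h1 : (heavyCount n D T : ℝ) ^ 2 ≤ h ^ 2 := by gcongr
      calc k * avgDegree G - k * h ^ 2 / n = k / n * (n * avgDegree G - h ^ 2) := by field_simp
        _ ≤ k / n * M := by gcongr; linarith
    have havg : 0 ≤ avgDegree G := by unfold avgDegree; positivity
    refine (measure_mono (t := {ω' | c ≤ |sampleSum n k L.degQuery (fun _ => L.nbrNat) T cap D ω' -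
        k / n * M|}) ?_).trans ((coinLaw_deviation_le hn hk L.degQuery_nonneg hcap hc).trans ?_)
    · rintro ω' ⟨-, h2⟩
      simp only [Set.mem_ofPred_eq] at h2 ⊢
      have h2 : c + k * h ^ 2 / n < |privateSum L ε ρ (mix I ω ω') - k * avgDegree G| := h2
      rw [eP] at h2
      have h3 := abs_sub_le (sampleSum n k L.degQuery (fun _ => L.nbrNat) T cap D ω')
        (k / n * M) (k * avgDegree G)
      have h4 : |k / n * M - k * avgDegree G| ≤ k * h ^ 2 / n := by
        rw [abs_sub_comm, abs_of_nonneg (by linarith)]; linarith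
      linarith
    · refine ENNReal.ofReal_le_ofReal ?_
      have h5 : 2 * cap * (k / n * M) ≤ 2 * C * (k * avgDegree G) := by
        calc 2 * cap * (k / n * M) ≤ 2 * cap * (k * avgDegree G) := by gcongr
          _ ≤ 2 * C * (k * avgDegree G) := by gcongr
      gcongr
  · exact (measure_mono_null (fun ω' hω' => hgood ((eG ω').1 hω'.1)) measure_empty).trans_le
      zero_le

/-- Each noise term is at most (4 / ε) · 2 log n. It enters once in the threshold and once more in
the margin of `degCap`, hence the 16. -/
theorem goodThreshold_of {C B h : ℝ} (hε : 0 < ε) (hB : 0 ≤ B)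
    (hC : B + 16 * Real.log n / ε + 1 ≤ C) {ω : Coins}
    (h1 : ∀ v ≤ n, |logit (ω (4 * v + 4))| ≤ 2 * Real.log n)
    (h2 : ∀ j < preSize n ρ, L.degQuery (preVertex n ω j) ≤ B)
    (h3 : (heavyCount n (noisyDeg ε L.degQuery ω)
      (threshold n ρ (noisyDeg ε L.degQuery ω) ω) : ℝ) < h) :
    GoodThreshold L ε ρ C h ω := by
  have hlog := Real.log_natCast_nonneg n
  have hD (v : ℕ) (hv : v ≤ n) :
      |noisyDeg ε L.degQuery ω v - L.degQuery v| ≤ 8 * Real.log n / ε := by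
    have e : noisyDeg ε L.degQuery ω v - L.degQuery v = 4 / ε * logit (ω (4 * v + 4)) := by
      rw [noisyDeg]; ring
    rw [e, abs_mul, abs_of_pos (by positivity)]
    calc 4 / ε * |logit (ω (4 * v + 4))| ≤ 4 / ε * (2 * Real.log n) := by gcongr; exact h1 v hv
      _ = 8 * Real.log n / ε := by ring
  refine ⟨fun v hv hle => ?_, ?_, h3⟩
  · have := (abs_le.1 (hD v hv.le)).1
    unfold degCap; linarith
  · have hT : threshold n ρ (noisyDeg ε L.degQuery ω) ω ≤ B + 8 * Real.log n / ε := by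
      refine runMax_le _ (by positivity) fun j hj => ?_
      have := (abs_le.1 (hD _ (preVertex_le n ω j))).2
      linarith [h2 j hj]
    have : 16 * Real.log n / ε = 8 * Real.log n / ε + 8 * Real.log n / ε := by ring
    unfold degCap; linarith

/-- Accuracy of the estimate, in terms of a bound `B` for the degrees of the vertices that determine
the threshold, a bound `h` for the number of vertices above the threshold, a bound `t` for the noise
that is added to the estimate and a bound `c` for the deviation of the sum of the samples. -/
theorem coinLaw_estimate_error_le (hn : 0 < n) (hε : 0 < ε) {C B h c t : ℝ} (hB : 0 < B)
    (hh : 0 < h) (hc : 0 < c) (hC : B + 16 * Real.log n / ε + 1 ≤ C) {r : ℝ}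
    (hr : c + sampleSize n ρ * h ^ 2 / n + noiseScale n (sampleSize n ρ) ε C * t ≤
      sampleSize n ρ * r) :
    coinLaw {ω | r < |estimateOf n ε ρ L.degQuery (fun _ => L.nbrNat)
        (noisyDeg ε L.degQuery ω) ω - avgDegree G|} ≤
      ENNReal.ofReal (4 / n) + ENNReal.ofReal (preSize n ρ * avgDegree G / B) +
      ENNReal.ofReal (Real.exp (-(h * preSize n ρ / n))) +
      ENNReal.ofReal (2 * C * (sampleSize n ρ * avgDegree G) / c ^ 2) +
      ENNReal.ofReal (2 * Real.exp (-t)) := by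
  set k := sampleSize n ρ with hkdef
  have hk : (0 : ℝ) < k := by exact_mod_cast Nat.succ_pos _
  -- Outside five bad events (large degree noise, a high degree among the draws, too many heavy
  -- vertices, a deviating sum, large final noise) the error is at most `r`.
  refine (measure_mono (t := ((({ω | ∃ v ≤ n, 2 * Real.log n < |logit (ω (4 * v + 4))|} ∪
    {ω | ∃ j < preSize n ρ, B < L.degQuery (preVertex n ω j)}) ∪
    {ω | h ≤ heavyCount n (noisyDeg ε L.degQuery ω)
      (threshold n ρ (noisyDeg ε L.degQuery ω) ω)}) ∪
    {ω | GoodThreshold L ε ρ C h ω ∧ c + k * h ^ 2 / n <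
        |privateSum L ε ρ ω - k * avgDegree G|}) ∪ {ω | t < |logit (ω 0)|}) ?_).trans ?_
  · intro ω hω
    by_contra hc'
    simp only [Set.mem_union, Set.mem_ofPred_eq, not_or, not_exists, not_and, not_lt, not_le] at hc'
    obtain ⟨⟨⟨⟨c1, c2⟩, c3⟩, c4⟩, c5⟩ := hc'
    have hg := goodThreshold_of L ε ρ hε hB.le hC c1 c2 c3
    have hdev := c4 hg
    have hω : r < |estimateOf n ε ρ L.degQuery (fun _ => L.nbrNat)
        (noisyDeg ε L.degQuery ω) ω - avgDegree G| := hω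
    set cap := degCap n ε (threshold n ρ (noisyDeg ε L.degQuery ω) ω) with hcapdef
    have hcap : 0 ≤ cap := zero_le_one.trans (one_le_degCap n hε (runMax_nonneg _ _))
    have hns : noiseScale n k ε cap ≤ noiseScale n k ε C := by
      have := hg.2.1
      unfold noiseScale
      gcongr
    have hns0 : 0 ≤ noiseScale n k ε cap := by unfold noiseScale; positivity
    have hnoise : |noiseScale n k ε cap * logit (ω 0)| ≤ noiseScale n k ε C * t := by
      rw [abs_mul, abs_of_nonneg hns0]
      exact mul_le_mul hns c5 (abs_nonneg _) (hns0.trans hns)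
    have e : estimateOf n ε ρ L.degQuery (fun _ => L.nbrNat) (noisyDeg ε L.degQuery ω) ω -
        avgDegree G = ((privateSum L ε ρ ω - k * avgDegree G) +
          noiseScale n k ε cap * logit (ω 0)) / k := by
      rw [estimateOf, ← hkdef, ← hcapdef, privateSum]
      field_simp
      ring
    rw [e, abs_div, abs_of_pos hk, lt_div_iff₀ hk] at hω
    have := abs_add_le (privateSum L ε ρ ω - k * avgDegree G) (noiseScale n k ε cap * logit (ω 0))
    linarith
  · refine (measure_union_le _ _).trans (add_le_add ?_ (coinLaw_lt_abs_logit_le 0 t))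
    refine (measure_union_le _ _).trans (add_le_add ?_
      (coinLaw_privateSum_deviation_le L ε ρ hn hε hc))
    refine (measure_union_le _ _).trans (add_le_add ?_ (coinLaw_heavyCount_le hn ε ρ _ hh))
    exact (measure_union_le _ _).trans (add_le_add (coinLaw_exists_lt_abs_logit_le hn)
      (coinLaw_exists_lt_preVertex_le hn L hB _))

end Accuracy

/-! ### Accuracy for large graphs -/

theorem rootSize_pos (n : ℕ) : 0 < rootSize n := Real.exp_pos _

theorem rootSize_sq {n : ℕ} (hn : 0 < n) : rootSize n ^ 2 = n := by
  rw [rootSize, ← Real.exp_nat_mul]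
  push_cast
  rw [mul_div_cancel₀ _ two_ne_zero, Real.exp_log (by exact_mod_cast hn)]

theorem rootSize_eq_sqrt {n : ℕ} (hn : 0 < n) : rootSize n = √n := by
  rw [← rootSize_sq hn, Real.sqrt_sq (rootSize_pos n).le]

theorem one_le_rootSize (n : ℕ) : 1 ≤ rootSize n :=
  Real.one_le_exp (div_nonneg (Real.log_natCast_nonneg n) zero_le_two)

theorem le_preSize (n : ℕ) (ρ : ℝ) : rootSize n * logFactor n ρ ^ 2 ≤ preSize n ρ := by
  unfold preSize; push_cast; exact (Nat.lt_floor_add_one _).le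

theorem le_sampleSize (n : ℕ) (ρ : ℝ) : rootSize n * logFactor n ρ ^ 6 ≤ sampleSize n ρ := by
  unfold sampleSize; push_cast; exact (Nat.lt_floor_add_one _).le

theorem floor_add_one_le {x : ℝ} (hx : 1 ≤ x) : ((⌊x⌋₊ + 1 : ℕ) : ℝ) ≤ 2 * x := by
  have := Nat.floor_le (zero_le_one.trans hx)
  push_cast; linarith

theorem preSize_le (n : ℕ) {ρ : ℝ} (hρ : 0 < ρ) :
    preSize n ρ ≤ 2 * (rootSize n * logFactor n ρ ^ 2) :=
  floor_add_one_le (one_le_mul_of_one_le_of_one_le (one_le_rootSize n)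
    (one_le_pow₀ (Estimator.one_le_logFactor n hρ)))

theorem sampleSize_le (n : ℕ) {ρ : ℝ} (hρ : 0 < ρ) :
    sampleSize n ρ ≤ 2 * (rootSize n * logFactor n ρ ^ 6) :=
  floor_add_one_le (one_le_mul_of_one_le_of_one_le (one_le_rootSize n)
    (one_le_pow₀ (Estimator.one_le_logFactor n hρ)))

/-- The conditions on the size of the graph and the privacy parameter under which the estimate is
accurate. -/
def LargeEnough (n : ℕ) (ε ρ : ℝ) : Prop :=
  -- The summands serve, in order, the final noise (216 = 3 · 8 · 3 · 3), the cap, the bias from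
  -- pairs of heavy vertices and Chebyshev's inequality. The next condition gives k ≤ n; the last
  -- bounds both kinds of noise.
  0 < n ∧ 216 + 16 * ρ ^ 2 + 3 / ρ + 54 / ρ ^ 2 ≤ logFactor n ρ ∧
    2 * logFactor n ρ ^ 6 ≤ rootSize n ∧ 1 / ε ≤ ρ * logFactor n ρ

theorem exp_neg_le_inv {x : ℝ} (hx : 0 < x) : Real.exp (-x) ≤ 1 / x := by
  rw [Real.exp_neg, inv_eq_one_div]
  exact one_div_le_one_div_of_le hx (by linarith [Real.add_one_le_exp x])

theorem coinLaw_estimate_error_le_of_largeEnough {n : ℕ} {G : SimpleGraph (Fin n)}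
    (L : AdjLists G) {ε ρ : ℝ} (hε : 0 < ε) (hρ : 0 < ρ) (hL : LargeEnough n ε ρ)
    (havg : 1 ≤ avgDegree G) :
    coinLaw {ω | ρ * avgDegree G < |estimateOf n ε ρ L.degQuery (fun _ => L.nbrNat)
        (noisyDeg ε L.degQuery ω) ω - avgDegree G|} ≤ ENNReal.ofReal (6 / logFactor n ρ) := by
  obtain ⟨hn, hl, hroot, hinv⟩ := hL
  have hlog : Real.log n = ρ * (logFactor n ρ - 1) := by unfold logFactor; field_simp; ring
  have hk1 := le_sampleSize n ρ
  have hk2 := sampleSize_le n hρ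
  have hp1 := le_preSize n ρ
  have hp2 := preSize_le n hρ
  have hr2 := rootSize_sq hn
  have hr0 := one_le_rootSize n
  have hn' : (0 : ℝ) < n := by exact_mod_cast hn
  have hk0 : (0 : ℝ) < sampleSize n ρ := by exact_mod_cast Nat.succ_pos _
  have hp0 : (0 : ℝ) < preSize n ρ := by exact_mod_cast Nat.succ_pos _
  set l := logFactor n ρ
  set r := rootSize n
  set A := avgDegree G
  set k : ℝ := (sampleSize n ρ : ℝ) with hkdef
  set p : ℝ := (preSize n ρ : ℝ)
  have hl1 : 216 ≤ l := by
    have : 0 ≤ 16 * ρ ^ 2 + 3 / ρ + 54 / ρ ^ 2 := by positivity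
    linarith
  have hl2 : 16 * ρ ^ 2 + 1 ≤ l := by
    have : 0 ≤ 3 / ρ + 54 / ρ ^ 2 := by positivity
    linarith
  have hl3 : 3 / ρ ≤ l := by
    have : 0 ≤ 16 * ρ ^ 2 + 54 / ρ ^ 2 := by positivity
    linarith
  have hl4 : 54 / ρ ^ 2 ≤ l := by
    have : 0 ≤ 16 * ρ ^ 2 + 3 / ρ := by positivity
    linarith
  have hl0 : 0 < l := by linarith
  have hA0 : 0 < A := by linarith
  have hl16 : l ≤ l ^ 6 := le_self_pow₀ (by linarith) (by norm_num)
  have hkn : k ≤ n := by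
    calc k ≤ r * (2 * l ^ 6) := by linarith
      _ ≤ r * r := by gcongr
      _ = n := by rw [← hr2]; ring
  -- Two parts come from p ≤ 2 r l², the third absorbs the noise and the 1.
  set C : ℝ := 3 * (r * l ^ 3 * A) with hCdef
  have hC0 : 0 < C := by positivity
  have hC : p * l * A + 16 * Real.log n / ε + 1 ≤ C := by
    have h1 : p * l * A ≤ 2 * (r * l ^ 3 * A) := by
      calc p * l * A ≤ (2 * (r * l ^ 2)) * l * A := by gcongr
        _ = 2 * (r * l ^ 3 * A) := by ring
    have h2 : 16 * Real.log n / ε ≤ 16 * ρ ^ 2 * l ^ 2 := by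
      calc 16 * Real.log n / ε = 16 * (ρ * (l - 1)) * (1 / ε) := by rw [hlog]; ring
        _ ≤ 16 * (ρ * l) * (ρ * l) := by
            have : 0 ≤ l - 1 := by linarith
            gcongr
            linarith
        _ = 16 * ρ ^ 2 * l ^ 2 := by ring
    have h3 : 16 * ρ ^ 2 * l ^ 2 + 1 ≤ l ^ 3 := by
      have : 1 ≤ l ^ 2 := one_le_pow₀ (by linarith)
      calc 16 * ρ ^ 2 * l ^ 2 + 1 ≤ (16 * ρ ^ 2 + 1) * l ^ 2 := by linarith
        _ ≤ l * l ^ 2 := by gcongr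
        _ = l ^ 3 := by ring
    have h4 : l ^ 3 ≤ r * l ^ 3 * A := by
      calc l ^ 3 = 1 * l ^ 3 * 1 := by ring
        _ ≤ r * l ^ 3 * A := by gcongr
    linarith
  -- With these choices four of the failure probabilities are at most 1 / l and the last, from the
  -- final noise, at most 2 / l. Deviation, bias and noise each take a third of the permitted error.
  have hmain := coinLaw_estimate_error_le L ε ρ hn hε (C := C) (B := p * l * A) (h := r / l)
    (c := ρ / 3 * k * A) (t := l) (r := ρ * A) (by positivity) (by positivity) (by positivity) hC ?_
  · refine hmain.trans ?_
    rw [← ENNReal.ofReal_add (by positivity) (by positivity),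
      ← ENNReal.ofReal_add (by positivity) (by positivity),
      ← ENNReal.ofReal_add (by positivity) (by positivity),
      ← ENNReal.ofReal_add (by positivity) (by positivity)]
    refine ENNReal.ofReal_le_ofReal ?_
    have e1 : 4 / (n : ℝ) ≤ 1 / l := by
      rw [div_le_div_iff₀ hn' hl0, one_mul, ← hr2, sq]
      have h2 : 2 * l ≤ r := by linarith
      calc 4 * l ≤ 2 * l * (2 * l) := by nlinarith
        _ ≤ r * r := by gcongr
    have e2 : p * A / (p * l * A) = 1 / l := by field_simp
    have e3 : Real.exp (-(r / l * p / n)) ≤ 1 / l := by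
      refine le_trans (Real.exp_le_exp.2 (neg_le_neg ?_)) (exp_neg_le_inv hl0)
      rw [le_div_iff₀ hn', ← hr2]
      calc l * r ^ 2 = r / l * (r * l ^ 2) := by field_simp
        _ ≤ r / l * p := by gcongr
    have e4 : 2 * C * (k * A) / (ρ / 3 * k * A) ^ 2 ≤ 1 / l := by
      have e : 2 * C * (k * A) / (ρ / 3 * k * A) ^ 2 = 54 / ρ ^ 2 * (r * l ^ 3) / k := by
        rw [hCdef]; field_simp; ring
      rw [e, div_le_div_iff₀ hk0 hl0, one_mul]
      calc 54 / ρ ^ 2 * (r * l ^ 3) * l ≤ l * (r * l ^ 3) * l := by gcongr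
        _ = r * l ^ 5 := by ring
        _ ≤ r * l ^ 6 := by gcongr <;> linarith
        _ ≤ k := hk1
    have e5 : 2 * Real.exp (-l) ≤ 2 * (1 / l) := by
      have := exp_neg_le_inv hl0
      linarith
    have e6 : 6 / l = 6 * (1 / l) := by ring
    rw [e2, e6]
    linarith
  · have f1 : k * (r / l) ^ 2 / n ≤ k * (ρ / 3 * A) := by
      have : k * (r / l) ^ 2 / n = k * (1 / l ^ 2) := by rw [← hr2]; field_simp
      rw [this]
      have h3 : 1 / l ≤ ρ / 3 := by
        rw [div_le_iff₀ hρ] at hl3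
        rw [div_le_div_iff₀ hl0 (by norm_num)]
        linarith
      have h4 : 1 / l ^ 2 ≤ 1 / l := by
        apply one_div_le_one_div_of_le hl0
        nlinarith
      have h5 : ρ / 3 ≤ ρ / 3 * A := le_mul_of_one_le_right (by positivity) havg
      gcongr
      linarith
    have f2 : noiseScale n (sampleSize n ρ) ε C * l ≤ k * (ρ / 3 * A) := by
      have hkn' : k / n + 2 ≤ 3 := by
        have := (div_le_one hn').2 hkn
        linarith
      have e : noiseScale n (sampleSize n ρ) ε C * l = 8 * C * (k / n + 2) * (1 / ε) * l := by
        rw [noiseScale]; ring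
      rw [e]
      calc 8 * C * (k / n + 2) * (1 / ε) * l ≤ 8 * C * 3 * (ρ * l) * l := by gcongr
        _ = ρ / 3 * A * (216 * (r * l ^ 5)) := by rw [hCdef]; ring
        _ ≤ ρ / 3 * A * (l * (r * l ^ 5)) := by gcongr
        _ = ρ / 3 * A * (r * l ^ 6) := by ring
        _ ≤ ρ / 3 * A * k := by gcongr
        _ = k * (ρ / 3 * A) := by ring
    have : sampleSize n ρ * (ρ * A) = ρ / 3 * k * A + k * (ρ / 3 * A) + k * (ρ / 3 * A) := by
      rw [← hkdef]; ring
    linarith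

theorem tendsto_log_natCast : Tendsto (fun n : ℕ => Real.log n) atTop atTop :=
  Real.tendsto_log_atTop.comp tendsto_natCast_atTop_atTop

theorem tendsto_logFactor {ρ : ℝ} (hρ : 0 < ρ) :
    Tendsto (fun n : ℕ => logFactor n ρ) atTop atTop :=
  tendsto_atTop_add_const_left _ _ (tendsto_log_natCast.atTop_div_const hρ)

/-- The logarithmic factor tends to infinity while its powers stay below √n. For the privacy
parameter, log^{1/4} n is relaxed to log n, which is below ρ l. -/
theorem eventually_largeEnough {ρ : ℝ} (hρ : 0 < ρ) {ε : ℕ → ℝ}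
    (h : (fun n : ℕ => (ε n)⁻¹) =o[atTop] (fun n : ℕ => Real.log n ^ (1 / 4 : ℝ))) :
    ∀ᶠ n in atTop, LargeEnough n (ε n) ρ := by
  have h1 := (tendsto_logFactor hρ).eventually_ge_atTop (216 + 16 * ρ ^ 2 + 3 / ρ + 54 / ρ ^ 2)
  have h2 := tendsto_log_natCast.eventually_ge_atTop 1
  have h3 := h.bound one_pos
  have h4 : ∀ᶠ n : ℕ in atTop, Real.log n ^ 12 ≤ ((2 * (1 + 1 / ρ) ^ 6) ^ 2)⁻¹ * n := by
    have := (Real.isLittleO_pow_log_id_atTop (n := 12)).bound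
      (c := ((2 * (1 + 1 / ρ) ^ 6) ^ 2)⁻¹) (by positivity)
    filter_upwards [tendsto_natCast_atTop_atTop.eventually this, h2] with n hn h2
    simpa [abs_of_nonneg (zero_le_one.trans h2)] using hn
  filter_upwards [eventually_gt_atTop 0, h1, h2, h3, h4] with n hn h1 h2 h3 h4
  refine ⟨hn, h1, ?_, ?_⟩
  · have hl : logFactor n ρ ≤ (1 + 1 / ρ) * Real.log n := by
      have : logFactor n ρ = 1 + 1 / ρ * Real.log n := by unfold logFactor; ring
      rw [this]; linarith
    have hl0 := Estimator.one_le_logFactor n hρ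
    have h5 : 2 * logFactor n ρ ^ 6 ≤ 2 * (1 + 1 / ρ) ^ 6 * Real.log n ^ 6 := by
      calc 2 * logFactor n ρ ^ 6 ≤ 2 * ((1 + 1 / ρ) * Real.log n) ^ 6 := by gcongr
        _ = 2 * (1 + 1 / ρ) ^ 6 * Real.log n ^ 6 := by ring
    refine h5.trans (le_of_sq_le_sq ?_ (rootSize_pos n).le)
    rw [rootSize_sq hn, mul_pow]
    calc (2 * (1 + 1 / ρ) ^ 6) ^ 2 * (Real.log n ^ 6) ^ 2
        = (2 * (1 + 1 / ρ) ^ 6) ^ 2 * Real.log n ^ 12 := by ring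
      _ ≤ (2 * (1 + 1 / ρ) ^ 6) ^ 2 * (((2 * (1 + 1 / ρ) ^ 6) ^ 2)⁻¹ * n) := by gcongr
      _ = n := by field_simp
  · have h6 : 1 / ε n ≤ Real.log n ^ (1 / 4 : ℝ) := by
      rw [one_mul, Real.norm_of_nonneg (Real.rpow_nonneg (by linarith) _)] at h3
      rw [one_div]
      exact (le_abs_self _).trans h3
    have h7 : Real.log n ^ (1 / 4 : ℝ) ≤ Real.log n := by
      conv_rhs => rw [← Real.rpow_one (Real.log n)]
      exact Real.rpow_le_rpow_of_exponent_le h2 (by norm_num)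
    have h8 : ρ * logFactor n ρ = ρ + Real.log n := by unfold logFactor; field_simp
    linarith

theorem accuracy_program {ρ : ℝ} (hρ : 0 < ρ) {ε : ℕ → ℝ} (hε : ∀ n, 0 < ε n)
    (h : (fun n : ℕ => (ε n)⁻¹) =o[atTop] (fun n : ℕ => Real.log n ^ (1 / 4 : ℝ))) :
    ∃ δ : ℕ → ℝ, Tendsto δ atTop (𝓝 0) ∧
      ∀ (n : ℕ) (G : SimpleGraph (Fin n)) (L : AdjLists G), 1 ≤ avgDegree G →
        ENNReal.ofReal (1 - δ n) ≤ Estimator.program.prob L (ε n) ρ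
          (Set.Icc ((1 - ρ) * avgDegree G) ((1 + ρ) * avgDegree G)) := by
  classical
  -- For the remaining `n` the choice δ = 1 makes the claim empty.
  refine ⟨fun n => if LargeEnough n (ε n) ρ then 6 / logFactor n ρ else 1, ?_, ?_⟩
  · refine ((tendsto_logFactor hρ).const_div_atTop 6).congr' ?_
    filter_upwards [eventually_largeEnough hρ h] with n hn
    rw [if_pos hn]
  · intro n G L havg
    by_cases hL : LargeEnough n (ε n) ρ
    · simp only [if_pos hL]
      have hbad := coinLaw_estimate_error_le_of_largeEnough L (hε n) hρ hL havg
      set bad := {ω | ρ * avgDegree G < |estimateOf n (ε n) ρ L.degQuery (fun _ => L.nbrNat)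
        (noisyDeg (ε n) L.degQuery ω) ω - avgDegree G|}
      have hl := Estimator.one_le_logFactor n hρ
      rw [ENNReal.ofReal_sub _ (by positivity), ENNReal.ofReal_one, tsub_le_iff_right]
      calc (1 : ℝ≥0∞) = coinLaw Set.univ := measure_univ.symm
        _ ≤ coinLaw ({ω | Estimator.program.output L (ε n) ρ ω ∈
              Set.Icc ((1 - ρ) * avgDegree G) ((1 + ρ) * avgDegree G)} ∪ bad) := by
            refine measure_mono fun ω _ => ?_
            by_cases hω : ω ∈ bad
            · exact Or.inr hω
            · left
              have hω : |estimateOf n (ε n) ρ L.degQuery (fun _ => L.nbrNat)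
                (noisyDeg (ε n) L.degQuery ω) ω - avgDegree G| ≤ ρ * avgDegree G := not_lt.1 hω
              rw [abs_le] at hω
              rw [Set.mem_ofPred_eq, Estimator.output_program _ _ hρ]
              constructor <;> linarith
        _ ≤ _ := (measure_union_le _ _).trans (add_le_add_right hbad _)
    · simp [if_neg hL]

end SublinearDP

theorem theorem1 :
    ∃ P : SublinearDP.Prog,
      -- privacy
      (∀ (n : ℕ) (ε ρ : ℝ), 0 < ε → 0 < ρ → P.IsEdgeDP n ε ρ) ∧
      -- running time
      (∃ (C : ℝ) (a b : ℕ), ∀ (n : ℕ) (ε ρ : ℝ), 1 ≤ n → 0 < ε → 0 < ρ →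
        ∀ (G : SimpleGraph (Fin n)) (L : SublinearDP.AdjLists G) (ω : SublinearDP.Coins),
          (P.time L ε ρ ω : ℝ) ≤
            C * (√(n : ℝ) * (1 + Real.log n / ρ) ^ a * (1 + 1 / ε) ^ b)) ∧
      -- accuracy
      (∀ ρ : ℝ, 0 < ρ → ∀ ε : ℕ → ℝ, (∀ n, 0 < ε n) →
        (fun n : ℕ => (ε n)⁻¹) =o[atTop] (fun n : ℕ => Real.log n ^ (1 / 4 : ℝ)) →
        ∃ δ : ℕ → ℝ, Tendsto δ atTop (𝓝 0) ∧
          ∀ (n : ℕ) (G : SimpleGraph (Fin n)) (L : SublinearDP.AdjLists G),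
            1 ≤ SublinearDP.avgDegree G →
            ENNReal.ofReal (1 - δ n) ≤
              P.prob L (ε n) ρ (Set.Icc ((1 - ρ) * SublinearDP.avgDegree G)
                ((1 + ρ) * SublinearDP.avgDegree G))) := by
  -- The loop lengths do not depend on ε, so the exponent `b` is 0; the exponent 6 comes from
  -- `sampleSize`.
  refine ⟨SublinearDP.Estimator.program,
    fun n ε ρ hε hρ => SublinearDP.isEdgeDP_program n hε hρ, ⟨1000, 6, 0, ?_⟩,
    fun ρ hρ ε hε h => SublinearDP.accuracy_program hρ hε h⟩
  intro n ε ρ hn hε hρ G L ω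
  have ht : (SublinearDP.Estimator.program.time L ε ρ ω : ℝ) ≤
      200 + 100 * SublinearDP.preSize n ρ + 200 * SublinearDP.sampleSize n ρ := by
    exact_mod_cast SublinearDP.Estimator.time_program_le L ω hρ
  have hl := SublinearDP.Estimator.one_le_logFactor n hρ
  have h1 := SublinearDP.preSize_le n hρ
  have h2 := SublinearDP.sampleSize_le n hρ
  have hr := SublinearDP.one_le_rootSize n
  rw [pow_zero, mul_one, ← SublinearDP.rootSize_eq_sqrt hn, ← SublinearDP.logFactor.eq_1]
  set l := SublinearDP.logFactor n ρ
  set r := SublinearDP.rootSize n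
  have h3 : r * l ^ 2 ≤ r * l ^ 6 := by gcongr; norm_num
  have h4 : 1 ≤ r * l ^ 6 := one_le_mul_of_one_le_of_one_le hr (one_le_pow₀ hl)
  linarith
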